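/- Let $g\in C^1(\mathbb R)$ satisfy $g(0)=0$, $g'(0)<0$ and, for some $0<\theta<\gamma$, $g(\theta)=g(\gamma)=0$, $g<0$ on $(0,\theta)$ and $g>0$ on $(\theta,\gamma)$. Let $\lambda$ be a non-negative Borel measure on $\mathbb R\setminus\{0\}$ (viewed as a measure on $\mathbb R$ with $\lambda(\{0\})=0$) that is symmetric under $z\mapsto -z$, unbounded ($\lambda(\mathbb R)=+\infty$), has no atoms, satisfies $\int_{\mathbb R}\min(1,z^2)\,d\lambda(z)<+\infty$, and has $\operatorname{Supp}(\lambda)\subset(-r_0,r_0)$ for some $r_0>0$. For a measure $\mu$ write $$\mathcal D_\mu[u](x)=\mathrm{P.V.}\int_{\mathbb R}[u(x+z)-u(x)]\,d\mu(z)=\lim_{\delta\to0^+}\int_{|z|>\delta}[u(x+z)-u(x)]\,d\mu(z).$$ Let $\varepsilon_n>0$ with $\varepsilon_n\to0$ and let $\lambda_n:=\mathbb 1_{\mathbb R\setminus[-\varepsilon_n,\varepsilon_n]}\,\lambda$. Suppose that for every $n\in\mathbb N$ there are $c_n>0$ and a nonincreasing function $m_n\in C^2(\mathbb R)$ such that $$-c_n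 m_n'=\mathcal D_{\lambda_n}[m_n]+g(m_n)\ \text{ a.e. on }\mathbb R,\qquad \lim_{x\to-\infty}m_n(x)=\gamma,\qquad \lim_{x\to+\infty}m_n(x)=0,$$ and that $c_n\to0$ as $n\to+\infty$. Then there exists a continuous, positive, nonincreasing function $\overline m:\mathbb R\to\mathbb R$ such that, for almost every $x\in\mathbb R$, the limit defining $\mathcal D_\lambda[\overline m](x)$ exists and $$\mathcal D_\lambda[\overline m](x)+g(\overline m(x))=0,$$ and moreover $\lim_{x\to-\infty}\overline m(x)=\gamma$ and $\lim_{x\to+\infty}\overline m(x)=0$. -/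

import Mathlib

open MeasureTheory Set Filter Topology

/-- `ν` is a symmetric diffuse Lévy measure on `ℝ ∖ {0}`, viewed as a Borel measure on `ℝ`
that does not charge the origin. -/
structure IsSymmDiffuseLevy (ν : Measure ℝ) : Prop where
  zero : ν {0} = 0
  symm : ν.map (fun z => -z) = ν
  lintegral_lt_top : ∫⁻ z, ENNReal.ofReal (min 1 (z ^ 2)) ∂ν < ⊤
  diffuse : ∀ x : ℝ, x ≠ 0 → ν {x} = 0

/-- The truncation `𝟙_{ℝ ∖ [-ε, ε]} ν`. -/
noncomputable def levyTrunc (ν : Measure ℝ) (ε : ℝ) : Measure ℝ :=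
  ν.restrict (Icc (-ε) ε)ᶜ

/-- `D_ν[u](x)` exists and equals `L`, where
`D_ν[u](x) = P.V. ∫ (u (x + z) - u x) dν(z) = lim_{δ → 0+} ∫_{|z| > δ} (u (x + z) - u x) dν(z)`.
All the truncated integrals have to converge absolutely. -/
def HasNonlocalOp (ν : Measure ℝ) (u : ℝ → ℝ) (x L : ℝ) : Prop :=
  (∀ δ : ℝ, 0 < δ → Integrable (fun z => u (x + z) - u x) (levyTrunc ν δ)) ∧
  Tendsto (fun δ : ℝ => ∫ z, (u (x + z) - u x) ∂(levyTrunc ν δ)) (𝓝[>] 0) (𝓝 L)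

/-- A `C¹` nonlinearity of bistable shape with zeros `0 < θ < γ` (on `[0, γ]`). -/
structure IsBistable (g : ℝ → ℝ) (θ γ : ℝ) : Prop where
  contDiff : ContDiff ℝ 1 g
  zero : g 0 = 0
  deriv_zero_neg : deriv g 0 < 0
  theta_pos : 0 < θ
  theta_lt : θ < γ
  theta_zero : g θ = 0
  gamma_zero : g γ = 0
  neg : ∀ s ∈ Ioo 0 θ, g s < 0
  pos : ∀ s ∈ Ioo θ γ, 0 < g s

/-- `u` is a monotone decreasing (that is, nonincreasing) profile with limit `γ` at `-∞` and
`0` at `+∞`, and `-c u' = D_ν[u] + g(u)` holds almost everywhere. -/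
structure IsFront (ν : Measure ℝ) (g : ℝ → ℝ) (γ c : ℝ) (u : ℝ → ℝ) : Prop where
  antitone : Antitone u
  eqn : ∀ᵐ x : ℝ, ∃ L : ℝ, HasNonlocalOp ν u x L ∧ -c * deriv u x = L + g (u x)
  tendsto_atBot : Tendsto u atBot (𝓝 γ)
  tendsto_atTop : Tendsto u atTop (𝓝 0)

/-! Translate the fronts so that they equal `θ / 2` at `0`, and extract a Helly limit `w`. It
remains to show that `w` is continuous, that the equation holds as a pointwise principal value
although `w` need not be smooth, and that the limits at infinity are the right ones.

Continuity: testing the equation for an increment v = u(· + h) - u against v removes the drift,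
since c v v' is an exact derivative. This bounds ∬ |v(x+z) - v(x)|² dx dν_n(z) by a constant times
h, uniformly in n (`IsTruncFront.energy_le`). Fatou carries the bound to `w`. A jump of `w` would
force the energy above a constant times h ν(h < |z| < η), and ν would be finite
(`continuous_of_energy_le`).

Equation: average at scale h against the tent kernel. By `secondDiff_tentAvg` the second differences
of a tent average are O(z²) for any bounded continuous function, so the averaged equations pass to
the limit and give D_ν[tentAvg h w] = -tentAvg h (g ∘ w) for every h ≠ 0. To let h → 0 at almost
every point, the operators truncated at δ, applied to the difference of the averages at scales
2^(-j) and 2^(-j-1), are bounded uniformly in δ. Second differences are commuting nonpositive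
operators on L², so disjoint shells of |z| contribute functions with nonnegative inner products, and
a Rademacher–Menshov argument controls the maximal function at logarithmic cost. Monotonicity gives
`w` and g ∘ w an L² modulus of order one half, which supplies geometric decay in j
(`exists_geometric_bound`, `ae_hasNonlocalOp`).

Limits: the averaged equation at large scales R shows that tent averages of g ∘ w are O(R⁻²), so g
vanishes at both limits of `w`. The normalisation leaves 0 at +∞, and θ or γ at -∞. With θ, g ∘ w
would be nonpositive and negative at 0, and its averages would be at least of order 1/R. -/

/-! ### Tent averages and second differences. -/

/-- The probability measure on `ℝ` with density `max (1 - |t|) 0`. -/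
noncomputable def tentMeasure : Measure ℝ :=
  volume.withDensity (fun t => ENNReal.ofReal (1 - |t|))

/-- The average of `u` around `x` at scale `h` against the tent kernel. -/
noncomputable def tentAvg (h : ℝ) (u : ℝ → ℝ) (x : ℝ) : ℝ :=
  ∫ t, u (x + h * t) ∂tentMeasure

/-- The symmetric second difference of `u` at `x` with step `z`. -/
def secondDiff (z : ℝ) (u : ℝ → ℝ) (x : ℝ) : ℝ := u (x + z) + u (x - z) - 2 * u x

lemma measurable_tentDensity : Measurable (fun t : ℝ => ENNReal.ofReal (1 - |t|)) := by
  fun_prop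

lemma integral_tentMeasure_eq {F : ℝ → ℝ} (hF : Continuous F) :
    ∫ t, F t ∂tentMeasure = ∫ t in (0 : ℝ)..1, (1 - t) * (F t + F (-t)) := by
  rw [tentMeasure, integral_withDensity_eq_integral_toReal_smul measurable_tentDensity
    (ae_of_all _ fun _ => ENNReal.ofReal_lt_top)]
  have h1 : ∀ t : ℝ, (ENNReal.ofReal (1 - |t|)).toReal • F t
      = (Ioc (-1 : ℝ) 1).indicator (fun t => (1 - |t|) * F t) t := by
    intro t
    by_cases ht : t ∈ Ioc (-1 : ℝ) 1
    · rw [indicator_of_mem ht, ENNReal.toReal_ofReal, smul_eq_mul]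
      have := abs_le.2 ⟨ht.1.le, ht.2⟩
      linarith
    · rw [indicator_of_notMem ht]
      have : 1 - |t| ≤ 0 := by
        by_contra hc
        push Not at hc
        have := abs_lt.1 (show |t| < 1 by linarith)
        exact ht ⟨this.1, this.2.le⟩
      rw [ENNReal.ofReal_of_nonpos this]; simp
  simp_rw [h1]
  rw [integral_indicator measurableSet_Ioc, ← intervalIntegral.integral_of_le (by norm_num)]
  have hc : Continuous (fun t : ℝ => (1 - |t|) * F t) := by fun_prop
  rw [← intervalIntegral.integral_add_adjacent_intervals (b := 0)
    (hc.intervalIntegrable _ _) (hc.intervalIntegrable _ _)]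
  have h2 : ∫ t in (-1 : ℝ)..0, (1 - |t|) * F t = ∫ t in (0 : ℝ)..1, (1 - |t|) * F (-t) := by
    have := intervalIntegral.integral_comp_neg (a := 0) (b := 1) (fun t : ℝ => (1 - |t|) * F t)
    simp only [abs_neg, neg_zero] at this
    exact this.symm
  have hc' : Continuous (fun t : ℝ => (1 - |t|) * F (-t)) := by fun_prop
  rw [h2, ← intervalIntegral.integral_add (hc'.intervalIntegrable _ _) (hc.intervalIntegrable _ _)]
  refine intervalIntegral.integral_congr fun t ht => ?_
  rw [uIcc_of_le zero_le_one] at ht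
  simp only [abs_of_nonneg ht.1]
  ring

instance : IsProbabilityMeasure tentMeasure := by
  have := integral_tentMeasure_eq (F := fun _ => 1) continuous_const
  have h2 : ∫ t in (0 : ℝ)..1, (1 - t) * ((1 : ℝ) + 1) = 1 := by
    simp only [intervalIntegral.integral_mul_const]
    rw [intervalIntegral.integral_sub (by simp) (by simp)]
    simp; norm_num
  rw [h2] at this
  simp only [integral_const, smul_eq_mul, mul_one] at this
  refine ⟨?_⟩
  rw [← ENNReal.toReal_eq_one_iff]
  exact this

lemma tentMeasure_abs_le : ∀ᵐ t ∂tentMeasure, |t| ≤ 1 := by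
  rw [tentMeasure, ae_withDensity_iff measurable_tentDensity]
  refine ae_of_all _ fun t ht => ?_
  by_contra hc
  push Not at hc
  exact ht (ENNReal.ofReal_of_nonpos (by linarith))

lemma integrable_tent {F : ℝ → ℝ} (hF : Continuous F) : Integrable F tentMeasure := by
  obtain ⟨C, hC⟩ := isCompact_Icc (a := (-1 : ℝ)) (b := 1) |>.exists_bound_of_continuousOn
    hF.continuousOn
  refine Integrable.of_bound hF.aestronglyMeasurable C ?_
  filter_upwards [tentMeasure_abs_le] with t ht using hC t (abs_le.1 ht)

lemma integrable_tent_comp {u : ℝ → ℝ} (hu : Continuous u) (h x : ℝ) :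
    Integrable (fun t => u (x + h * t)) tentMeasure := integrable_tent (by fun_prop)

/-- If `U'' = u`, then `h² · tentAvg h u` is the second difference of `U`. -/
lemma sq_mul_tentAvg {U U' u : ℝ → ℝ} (hU : ∀ x, HasDerivAt U (U' x) x)
    (hU' : ∀ x, HasDerivAt U' (u x) x) (hu : Continuous u) (h x : ℝ) :
    h ^ 2 * tentAvg h u x = secondDiff h U x := by
  -- Taylor's formula with integral remainder. Adding the cases `h` and `-h` cancels the first-order
  -- terms.
  have key : ∀ k : ℝ, ∫ t in (0 : ℝ)..1, k ^ 2 * ((1 - t) * u (x + k * t))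
      = U (x + k) - U x - k * U' x := by
    intro k
    have hd : ∀ t ∈ uIcc (0 : ℝ) 1, HasDerivAt
        (fun t => (1 - t) * (k * U' (x + k * t)) + U (x + k * t))
        (k ^ 2 * ((1 - t) * u (x + k * t))) t := by
      intro t _
      have hl : HasDerivAt (fun t : ℝ => x + k * t) k t := by
        simpa using ((hasDerivAt_id t).const_mul k).const_add x
      have h1 := ((hasDerivAt_id t).const_sub 1).mul (((hU' _).comp t hl).const_mul k)
      have h2 := (hU _).comp t hl
      refine (h1.add h2).congr_deriv ?_
      simp
      ring
    rw [intervalIntegral.integral_eq_sub_of_hasDerivAt hd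
      (Continuous.intervalIntegrable (by fun_prop) _ _)]
    simp
    ring
  have hp := key h
  have hm := key (-h)
  rw [tentAvg, integral_tentMeasure_eq (by fun_prop), ← intervalIntegral.integral_const_mul,
    secondDiff]
  have : ∫ t in (0 : ℝ)..1, h ^ 2 * ((1 - t) * (u (x + h * t) + u (x + h * -t)))
      = (∫ t in (0 : ℝ)..1, h ^ 2 * ((1 - t) * u (x + h * t)))
        + ∫ t in (0 : ℝ)..1, (-h) ^ 2 * ((1 - t) * u (x + (-h) * t)) := by
    rw [← intervalIntegral.integral_add (Continuous.intervalIntegrable (by fun_prop) _ _)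
      (Continuous.intervalIntegrable (by fun_prop) _ _)]
    congr 1; ext t
    rw [show x + h * -t = x + -h * t by ring]; ring
  rw [this, hp, hm]
  rw [show x + -h = x - h by ring]; ring

lemma exists_double_primitive {u : ℝ → ℝ} (hu : Continuous u) :
    ∃ U U' : ℝ → ℝ, (∀ x, HasDerivAt U (U' x) x) ∧ ∀ x, HasDerivAt U' (u x) x := by
  have h1 : ∀ x, HasDerivAt (fun x => ∫ t in (0 : ℝ)..x, u t) (u x) x := fun x =>
    intervalIntegral.integral_hasDerivAt_right (hu.intervalIntegrable _ _)
      hu.stronglyMeasurable.stronglyMeasurableAtFilter hu.continuousAt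
  have hc : Continuous (fun x => ∫ t in (0 : ℝ)..x, u t) :=
    continuous_iff_continuousAt.2 fun x => (h1 x).continuousAt
  exact ⟨fun x => ∫ s in (0 : ℝ)..x, ∫ t in (0 : ℝ)..s, u t, _, fun x =>
    intervalIntegral.integral_hasDerivAt_right (hc.intervalIntegrable _ _)
      hc.stronglyMeasurable.stronglyMeasurableAtFilter hc.continuousAt, h1⟩

lemma continuous_secondDiff {u : ℝ → ℝ} (hu : Continuous u) (z : ℝ) :
    Continuous (secondDiff z u) := by
  unfold secondDiff; fun_prop

lemma tentAvg_secondDiff {u : ℝ → ℝ} (hu : Continuous u) (z h x : ℝ) :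
    tentAvg z (secondDiff h u) x = secondDiff h (tentAvg z u) x := by
  simp only [tentAvg, secondDiff]
  rw [← integral_const_mul, ← integral_add (integrable_tent (by fun_prop))
    (integrable_tent (by fun_prop)), ← integral_sub (integrable_tent (by fun_prop))
    (integrable_tent (by fun_prop))]
  congr 1; ext t
  rw [show x + z * t + h = x + h + z * t by ring, show x + z * t - h = x - h + z * t by ring]

/-- Second differences of a tent average are tent averages of second differences. -/
lemma secondDiff_tentAvg {u : ℝ → ℝ} (hu : Continuous u) (z x : ℝ) {h : ℝ} (hh : h ≠ 0) :
    secondDiff z (tentAvg h u) x = z ^ 2 * (tentAvg z (secondDiff h u) x / h ^ 2) := by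
  -- With u = U'', both sides times h² are the iterated second difference of U with steps h and z,
  -- which is symmetric in the two steps.
  obtain ⟨U, U', hU, hU'⟩ := exists_double_primitive hu
  have e := fun k y => sq_mul_tentAvg hU hU' hu k y
  rw [mul_div_assoc', eq_div_iff (by positivity), tentAvg_secondDiff hu]
  have h1 : secondDiff z (tentAvg h u) x * h ^ 2 = h ^ 2 * tentAvg h u (x + z)
      + h ^ 2 * tentAvg h u (x - z) - 2 * (h ^ 2 * tentAvg h u x) := by
    simp only [secondDiff]; ring
  have h2 : z ^ 2 * secondDiff h (tentAvg z u) x = z ^ 2 * tentAvg z u (x + h)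
      + z ^ 2 * tentAvg z u (x - h) - 2 * (z ^ 2 * tentAvg z u x) := by
    simp only [secondDiff]; ring
  rw [h1, h2]
  simp only [e, secondDiff]
  rw [show x + z + h = x + h + z by ring, show x + z - h = x - h + z by ring,
    show x - z + h = x + h - z by ring, show x - z - h = x - h - z by ring]
  ring

lemma abs_tentAvg_le {u : ℝ → ℝ} {C : ℝ} (hC : ∀ x, |u x| ≤ C) (h x : ℝ) :
    |tentAvg h u x| ≤ C := by
  have := norm_integral_le_of_norm_le_const (μ := tentMeasure) (f := fun t => u (x + h * t))
    (C := C) (ae_of_all _ fun t => hC _)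
  simpa [tentAvg] using this

lemma continuous_tentAvg_uncurry {u : ℝ → ℝ} (hu : Continuous u) {C : ℝ} (hC : ∀ x, |u x| ≤ C) :
    Continuous (fun p : ℝ × ℝ => tentAvg p.1 u p.2) := by
  unfold tentAvg
  refine continuous_of_dominated (bound := fun _ => C) ?_ ?_ (integrable_const C) ?_
  · intro p
    exact Continuous.aestronglyMeasurable (by fun_prop)
  · intro p
    exact ae_of_all _ fun t => hC _
  · exact ae_of_all _ fun t => by fun_prop

lemma tentAvg_zero (u : ℝ → ℝ) (x : ℝ) : tentAvg 0 u x = u x := by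
  simp [tentAvg]

/-- Dominated convergence for tent averages. -/
lemma tendsto_tentAvg {ι : Type*} {l : Filter ι} [l.IsCountablyGenerated] {u : ι → ℝ → ℝ}
    {w : ℝ → ℝ} (hu : ∀ n, Continuous (u n)) {C : ℝ} (hC : ∀ n x, |u n x| ≤ C)
    (hlim : ∀ x, Tendsto (fun n => u n x) l (𝓝 (w x))) (h x : ℝ) :
    Tendsto (fun n => tentAvg h (u n) x) l (𝓝 (tentAvg h w x)) := by
  unfold tentAvg
  refine tendsto_integral_filter_of_dominated_convergence (fun _ => C) ?_ ?_ (integrable_const C) ?_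
  · exact Eventually.of_forall fun n => Continuous.aestronglyMeasurable (by have := hu n; fun_prop)
  · exact Eventually.of_forall fun n => ae_of_all _ fun t => hC _ _
  · exact ae_of_all _ fun t => hlim _

/-! ### Maximal inequality for positively correlated sums. -/

/-- Expand the square on the right and drop the nonnegative off-diagonal terms. -/
lemma integral_sum_sq_le {a : ℕ → ℝ → ℝ} (ha : ∀ i, MemLp (a i) 2 volume)
    (hpos : ∀ i j, 0 ≤ ∫ x, a i x * a j x) (n : ℕ) :
    ∫ x, ∑ i ∈ Finset.range n, a i x ^ 2 ≤ ∫ x, (∑ i ∈ Finset.range n, a i x) ^ 2 := by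
  have hi : ∀ i j, Integrable (fun x => a i x * a j x) := fun i j => (ha i).integrable_mul (ha j)
  simp_rw [sq, Finset.sum_mul_sum]
  rw [integral_finsetSum _ fun i _ => hi i i,
    integral_finsetSum _ fun i _ => integrable_finsetSum _ fun j _ => hi i j]
  refine Finset.sum_le_sum fun i hin => ?_
  rw [integral_finsetSum _ fun j _ => hi i j]
  exact Finset.single_le_sum (f := fun j => ∫ x, a i x * a j x) (fun j _ => hpos i j) hin

lemma sum_range_two_mul (a : ℕ → ℝ) (n : ℕ) :
    ∑ i ∈ Finset.range (2 * n), a i = ∑ i ∈ Finset.range n, (a (2 * i) + a (2 * i + 1)) := by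
  induction n with
  | zero => simp
  | succ n ih =>
    rw [show 2 * (n + 1) = 2 * n + 1 + 1 by ring, Finset.sum_range_succ, Finset.sum_range_succ, ih,
      Finset.sum_range_succ]
    ring

/-- A Rademacher–Menshov maximal inequality for the partial sums of square integrable functions
with pairwise nonnegative inner products. -/
lemma exists_maximal_partial_sums (J : ℕ) {a : ℕ → ℝ → ℝ} (ha : ∀ i, MemLp (a i) 2 volume)
    (hpos : ∀ i j, 0 ≤ ∫ x, a i x * a j x) :
    ∃ Q : ℝ → ℝ, Integrable Q ∧ (∀ x, 0 ≤ Q x) ∧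
      ∫ x, Q x ≤ (J + 1) * ∫ x, (∑ i ∈ Finset.range (2 ^ J), a i x) ^ 2 ∧
      ∀ x, ∀ k ≤ 2 ^ J, (∑ i ∈ Finset.range k, a i x) ^ 2 ≤ (J + 1) * Q x := by
  induction J generalizing a with
  | zero =>
    refine ⟨fun x => a 0 x ^ 2, (ha 0).integrable_sq, fun x => sq_nonneg _, by simp, ?_⟩
    intro x k hk
    simp only [pow_zero] at hk
    interval_cases k
    · simpa using sq_nonneg _
    · simp
  | succ J ih =>
    have hi : ∀ i j, Integrable (fun x => a i x * a j x) := fun i j => (ha i).integrable_mul (ha j)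
    -- Adding consecutive terms in pairs halves the length and preserves the nonnegativity of inner
    -- products, so the induction hypothesis applies to the paired sequence.
    have hb : ∀ i, MemLp (fun x => a (2 * i) x + a (2 * i + 1) x) 2 volume :=
      fun i => (ha _).add (ha _)
    have hbpos : ∀ i j, 0 ≤ ∫ x, (a (2 * i) x + a (2 * i + 1) x)
        * (a (2 * j) x + a (2 * j + 1) x) := by
      intro i j
      have : ∀ x, (a (2 * i) x + a (2 * i + 1) x) * (a (2 * j) x + a (2 * j + 1) x)
          = (a (2 * i) x * a (2 * j) x + a (2 * i) x * a (2 * j + 1) x)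
            + (a (2 * i + 1) x * a (2 * j) x + a (2 * i + 1) x * a (2 * j + 1) x) := by
        intro x; ring
      simp_rw [this]
      rw [integral_add (f := fun x => _ + _) (g := fun x => _ + _) ((hi _ _).add (hi _ _))
        ((hi _ _).add (hi _ _)), integral_add (hi _ _) (hi _ _), integral_add (hi _ _) (hi _ _)]
      have := hpos (2 * i) (2 * j)
      have := hpos (2 * i) (2 * j + 1)
      have := hpos (2 * i + 1) (2 * j)
      have := hpos (2 * i + 1) (2 * j + 1)
      positivity
    obtain ⟨Q, hQi, hQ0, hQle, hQ⟩ := ih hb hbpos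
    have hsq : Integrable (fun x => ∑ i ∈ Finset.range (2 ^ (J + 1)), a i x ^ 2) :=
      integrable_finsetSum _ fun i _ => (ha i).integrable_sq
    refine ⟨fun x => (∑ i ∈ Finset.range (2 ^ (J + 1)), a i x ^ 2) + Q x, hsq.add hQi,
      fun x => add_nonneg (Finset.sum_nonneg fun i _ => sq_nonneg _) (hQ0 x), ?_, ?_⟩
    · rw [integral_add hsq hQi]
      have h1 := integral_sum_sq_le ha hpos (2 ^ (J + 1))
      have h2 : ∀ x, ∑ i ∈ Finset.range (2 ^ (J + 1)), a i x
          = ∑ i ∈ Finset.range (2 ^ J), (a (2 * i) x + a (2 * i + 1) x) := by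
        intro x
        rw [pow_succ, mul_comm, sum_range_two_mul (fun i => a i x)]
      simp_rw [← h2] at hQle
      push_cast
      linarith
    · intro x k hk
      -- A partial sum is a paired partial sum plus at most one leftover term, whose square is below
      -- the full sum of squares.
      obtain ⟨l, r, hl, hr, rfl⟩ : ∃ l r, l ≤ 2 ^ J ∧ (r = 0 ∨ (r = 1 ∧ l < 2 ^ J)) ∧
          k = 2 * l + r := by
        refine ⟨k / 2, k % 2, ?_, ?_, by omega⟩ <;> rw [pow_succ] at hk <;> omega
      have hJ : (0 : ℝ) < J + 1 := by positivity
      have hpair := hQ x l hl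
      rw [← sum_range_two_mul (fun i => a i x)] at hpair
      set P := ∑ i ∈ Finset.range (2 * l), a i x
      set S := ∑ i ∈ Finset.range (2 ^ (J + 1)), a i x ^ 2
      obtain ⟨y, hy, hsum⟩ : ∃ y, y ^ 2 ≤ S ∧ ∑ i ∈ Finset.range (2 * l + r), a i x = P + y := by
        rcases hr with rfl | ⟨rfl, hl'⟩
        · exact ⟨0, by simpa using Finset.sum_nonneg fun i _ => sq_nonneg (a i x), by simp [P]⟩
        · refine ⟨a (2 * l) x, ?_, by rw [Finset.sum_range_succ]⟩
          refine Finset.single_le_sum (f := fun i => a i x ^ 2) (fun i _ => sq_nonneg _) ?_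
          rw [Finset.mem_range, pow_succ]; omega
      rw [hsum]
      push_cast
      -- Young's inequality with weight 1/(J+1), chosen so that the factor J+1 in the bound for P²
      -- grows only to J+2.
      have key : (P + y) ^ 2 * (J + 1) ≤ (J + 1 + 1) * (P ^ 2 + (J + 1) * y ^ 2) := by
        nlinarith [sq_nonneg (P - (J + 1) * y)]
      have key2 : (P + y) ^ 2 * (J + 1) ≤ ((J + 1 + 1) * (S + Q x)) * (J + 1) := by
        refine key.trans ?_
        have : P ^ 2 + (J + 1) * y ^ 2 ≤ (S + Q x) * (J + 1) := by nlinarith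
        calc (J + 1 + 1 : ℝ) * (P ^ 2 + (J + 1) * y ^ 2)
            ≤ (J + 1 + 1) * ((S + Q x) * (J + 1)) := by gcongr
          _ = _ := by ring
      exact le_of_mul_le_mul_right key2 hJ

/-! ### Positivity of second differences on L². -/

lemma memLp_comp_add_const {F : ℝ → ℝ} (hF : MemLp F 2 volume) (a : ℝ) :
    MemLp (fun x => F (x + a)) 2 volume :=
  hF.comp_measurePreserving (measurePreserving_add_right volume a)

/-- The adjoint of translation by `a` is translation by `-a`, so central differences are
skew-adjoint. -/
lemma integral_centralDiff_mul {F G : ℝ → ℝ} (hF : MemLp F 2 volume) (hG : MemLp G 2 volume)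
    (a : ℝ) : ∫ x, (F (x + a) - F (x + -a)) * G x = -∫ x, F x * (G (x + a) - G (x + -a)) := by
  have hFa := memLp_comp_add_const hF
  have hGa := memLp_comp_add_const hG
  have i1 : ∀ a, Integrable (fun x => F (x + a) * G x) := fun a => (hFa a).integrable_mul hG
  have i2 : ∀ a, Integrable (fun x => F x * G (x + a)) := fun a => hF.integrable_mul (hGa a)
  have e : ∀ a, ∫ x, F (x + a) * G x = ∫ x, F x * G (x + -a) := by
    intro a
    have := integral_add_right_eq_self (μ := volume) (fun x => F x * G (x + -a)) a
    simpa using this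
  simp_rw [sub_mul, mul_sub]
  rw [integral_sub (i1 _) (i1 _), integral_sub (i2 _) (i2 _), e, e, neg_neg]
  ring

/-- Second difference operators are commuting nonpositive operators on `L²`. -/
lemma integral_secondDiff_mul_secondDiff_nonneg {v : ℝ → ℝ} (hv : MemLp v 2 volume) (z y : ℝ) :
    0 ≤ ∫ x, secondDiff z v x * secondDiff y v x := by
  set d : ℝ → (ℝ → ℝ) → ℝ → ℝ := fun a F x => F (x + a) - F (x + -a) with hd
  have hmem : ∀ a F, MemLp F 2 volume → MemLp (d a F) 2 volume := fun a F hF =>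
    (memLp_comp_add_const hF a).sub (memLp_comp_add_const hF (-a))
  -- A second difference is the square of a central difference with half the step. As these commute
  -- and are skew-adjoint, the inner product equals the squared norm of `d (z / 2) (d (y / 2) v)`.
  have hsd : ∀ a, secondDiff a v = d (a / 2) (d (a / 2) v) := by
    intro a; ext x
    simp only [hd, secondDiff]
    rw [show x + a / 2 + a / 2 = x + a by ring, show x + a / 2 + -(a / 2) = x by ring,
      show x + -(a / 2) + a / 2 = x by ring, show x + -(a / 2) + -(a / 2) = x - a by ring]
    ring
  have hcomm : ∀ a b F, d a (d b F) = d b (d a F) := by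
    intro a b F; ext x
    simp only [hd]
    rw [show x + a + b = x + b + a by ring, show x + a + -b = x + -b + a by ring,
      show x + -a + b = x + b + -a by ring, show x + -a + -b = x + -b + -a by ring]
    ring
  have hz := hmem (z / 2) _ hv
  have hy := hmem (y / 2) _ hv
  have h1 : ∫ x, secondDiff z v x * secondDiff y v x
      = -∫ x, d (z / 2) v x * d (z / 2) (d (y / 2) (d (y / 2) v)) x := by
    rw [hsd, hsd]
    exact integral_centralDiff_mul hz (hmem _ _ hy) (z / 2)
  have h2 : ∫ x, d (y / 2) (d (z / 2) v) x * d (z / 2) (d (y / 2) v) x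
      = -∫ x, d (z / 2) v x * d (y / 2) (d (z / 2) (d (y / 2) v)) x :=
    integral_centralDiff_mul hz (hmem _ _ hy) (y / 2)
  rw [hcomm (z / 2) (y / 2) (d (y / 2) v)] at h1
  rw [h1, ← h2, hcomm (y / 2) (z / 2) v]
  exact integral_nonneg fun x => mul_self_nonneg _

/-! ### Squared L² norms and the half-order modulus. -/

/-- The squared `L²` norm of a function on the real line, as an extended nonnegative number. -/
noncomputable def sqNorm (F : ℝ → ℝ) : ENNReal := ∫⁻ x, ‖F x‖ₑ ^ 2

lemma memLp_two_of_sqNorm_lt_top {F : ℝ → ℝ} (hF : AEStronglyMeasurable F volume)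
    (h : sqNorm F < ⊤) : MemLp F 2 volume := by
  refine ⟨hF, ?_⟩
  rw [eLpNorm_lt_top_iff_lintegral_rpow_enorm_lt_top (by simp) (by simp)]
  simpa [sqNorm] using h

lemma sqNorm_eq_ofReal {F : ℝ → ℝ} (hF : MemLp F 2 volume) :
    sqNorm F = ENNReal.ofReal (∫ x, F x ^ 2) := by
  rw [ofReal_integral_eq_lintegral_ofReal hF.integrable_sq (ae_of_all _ fun x => sq_nonneg _)]
  refine lintegral_congr fun x => ?_
  rw [← Real.enorm_of_nonneg (sq_nonneg (F x)), enorm_pow]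

lemma enorm_add_sq_le (a b : ℝ) : ‖a + b‖ₑ ^ 2 ≤ 2 * ‖a‖ₑ ^ 2 + 2 * ‖b‖ₑ ^ 2 := by
  rw [← enorm_pow, ← enorm_pow, ← enorm_pow, Real.enorm_of_nonneg (sq_nonneg _),
    Real.enorm_of_nonneg (sq_nonneg _), Real.enorm_of_nonneg (sq_nonneg _),
    show (2 : ENNReal) = ENNReal.ofReal 2 by simp, ← ENNReal.ofReal_mul (by norm_num),
    ← ENNReal.ofReal_mul (by norm_num), ← ENNReal.ofReal_add (by positivity) (by positivity)]
  exact ENNReal.ofReal_le_ofReal (by nlinarith [sq_nonneg (a - b)])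

lemma sqNorm_add_le {F G : ℝ → ℝ} (hF : Measurable F) :
    sqNorm (fun x => F x + G x) ≤ 2 * sqNorm F + 2 * sqNorm G := by
  unfold sqNorm
  rw [← lintegral_const_mul' _ _ (by simp), ← lintegral_const_mul' _ _ (by simp),
    ← lintegral_add_left (by fun_prop)]
  exact lintegral_mono fun x => enorm_add_sq_le _ _

lemma sqNorm_const_mul (c : ℝ) (F : ℝ → ℝ) :
    sqNorm (fun x => c * F x) = ENNReal.ofReal (c ^ 2) * sqNorm F := by
  unfold sqNorm
  rw [← lintegral_const_mul' _ _ (by simp)]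
  refine lintegral_congr fun x => ?_
  rw [enorm_mul, mul_pow, ← enorm_pow c, Real.enorm_of_nonneg (sq_nonneg c)]

lemma sqNorm_comp_add (F : ℝ → ℝ) (a : ℝ) : sqNorm (fun x => F (x + a)) = sqNorm F :=
  lintegral_add_right_eq_self (fun x => ‖F x‖ₑ ^ 2) a

lemma sq_lintegral_le {α : Type*} [MeasurableSpace α] (μ : Measure α) {f : α → ENNReal}
    (hf : AEMeasurable f μ) : (∫⁻ t, f t ∂μ) ^ 2 ≤ μ univ * ∫⁻ t, f t ^ 2 ∂μ := by
  have h := ENNReal.lintegral_mul_le_Lp_mul_Lq μ (p := 2) (q := 2) (by constructor <;> norm_num)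
    (aemeasurable_const (b := (1 : ENNReal))) hf
  simp only [Pi.mul_apply, one_mul, ENNReal.one_rpow, lintegral_const] at h
  calc (∫⁻ t, f t ∂μ) ^ 2 ≤ (μ univ ^ (1 / 2 : ℝ) * (∫⁻ t, f t ^ (2 : ℝ) ∂μ) ^ (1 / 2 : ℝ)) ^ 2 := by
        gcongr
    _ = _ := by
        rw [mul_pow, ← ENNReal.rpow_natCast, ← ENNReal.rpow_mul, ← ENNReal.rpow_natCast,
          ← ENNReal.rpow_mul]
        simp

/-- Cauchy–Schwarz and Tonelli for averages. -/
lemma sqNorm_integral_le {α : Type*} [MeasurableSpace α] (μ : Measure α) [SFinite μ]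
    {Φ : α → ℝ → ℝ} (hΦ : Measurable (fun p : α × ℝ => Φ p.1 p.2)) :
    ∫⁻ x, (∫⁻ t, ‖Φ t x‖ₑ ∂μ) ^ 2 ≤ μ univ * ∫⁻ t, sqNorm (Φ t) ∂μ := by
  have hm : Measurable (fun p : α × ℝ => ‖Φ p.1 p.2‖ₑ ^ 2) := by fun_prop
  calc ∫⁻ x, (∫⁻ t, ‖Φ t x‖ₑ ∂μ) ^ 2
      ≤ ∫⁻ x, μ univ * ∫⁻ t, ‖Φ t x‖ₑ ^ 2 ∂μ := by
        refine lintegral_mono fun x => sq_lintegral_le μ ?_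
        have := (hΦ.comp (measurable_prodMk_right (y := x)))
        exact Measurable.aemeasurable (by simpa [Function.comp_def] using this.enorm)
    _ = μ univ * ∫⁻ x, ∫⁻ t, ‖Φ t x‖ₑ ^ 2 ∂μ := by
        rw [lintegral_const_mul]
        exact Measurable.lintegral_prod_left' hm
    _ = μ univ * ∫⁻ t, sqNorm (Φ t) ∂μ := by
        unfold sqNorm
        rw [lintegral_lintegral_swap]
        exact (hm.comp measurable_swap).aemeasurable

lemma sqNorm_integral_le' {α : Type*} [MeasurableSpace α] (μ : Measure α) [SFinite μ]
    {Φ : α → ℝ → ℝ} (hΦ : Measurable (fun p : α × ℝ => Φ p.1 p.2)) :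
    sqNorm (fun x => ∫ t, Φ t x ∂μ) ≤ μ univ * ∫⁻ t, sqNorm (Φ t) ∂μ := by
  refine le_trans (lintegral_mono fun x => ?_) (sqNorm_integral_le μ hΦ)
  gcongr
  exact enorm_integral_le_lintegral_enorm _

/-- `u` has an `L²` modulus of continuity of order one half. -/
def HasHalfModulus (K : ℝ) (u : ℝ → ℝ) : Prop :=
  ∀ a b, sqNorm (fun x => u (x + a) - u (x + b)) ≤ ENNReal.ofReal (K * |a - b|)

lemma sqNorm_tentAvg_le {q : ℝ → ℝ} (hq : Continuous q) (z : ℝ) :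
    sqNorm (tentAvg z q) ≤ sqNorm q := by
  refine (sqNorm_integral_le' tentMeasure (Φ := fun t x => q (x + z * t)) (by fun_prop)).trans ?_
  simp [sqNorm_comp_add]

/-- The shifts `z * t` and `y * t` differ by at most `|z - y|` on the support of the tent. This is
what permits discretising the scale later. -/
lemma HasHalfModulus.sqNorm_tentAvg_sub_le {q : ℝ → ℝ} {K : ℝ} (hK : HasHalfModulus K q)
    (hK0 : 0 ≤ K) (hq : Continuous q) (z y : ℝ) :
    sqNorm (fun x => tentAvg z q x - tentAvg y q x) ≤ ENNReal.ofReal (K * |z - y|) := by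
  have : ∀ x, tentAvg z q x - tentAvg y q x = ∫ t, q (x + z * t) - q (x + y * t) ∂tentMeasure :=
    fun x => (integral_sub (integrable_tent_comp hq z x) (integrable_tent_comp hq y x)).symm
  simp_rw [this]
  refine (sqNorm_integral_le' tentMeasure (Φ := fun t x => q (x + z * t) - q (x + y * t))
    (by fun_prop)).trans ?_
  rw [measure_univ, one_mul]
  calc ∫⁻ t, sqNorm (fun x => q (x + z * t) - q (x + y * t)) ∂tentMeasure
      ≤ ∫⁻ _, ENNReal.ofReal (K * |z - y|) ∂tentMeasure := by
        refine lintegral_mono_ae ?_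
        filter_upwards [tentMeasure_abs_le] with t ht
        refine (hK _ _).trans (ENNReal.ofReal_le_ofReal ?_)
        rw [← sub_mul, abs_mul]
        exact mul_le_mul_of_nonneg_left (mul_le_of_le_one_right (abs_nonneg _) ht) hK0
    _ = _ := by simp

lemma tentAvg_neg {q : ℝ → ℝ} (hq : Continuous q) (z x : ℝ) : tentAvg (-z) q x = tentAvg z q x := by
  rw [tentAvg, tentAvg, integral_tentMeasure_eq (by fun_prop), integral_tentMeasure_eq (by fun_prop)]
  congr 1; ext t
  rw [show x + -z * t = x + z * -t by ring, show x + -z * -t = x + z * t by ring, add_comm]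

lemma tentAvg_abs {q : ℝ → ℝ} (hq : Continuous q) (z x : ℝ) : tentAvg |z| q x = tentAvg z q x := by
  rcases abs_choice z with h | h <;> rw [h]
  exact tentAvg_neg hq z x

/-! ### Maximal inequality for superpositions of tent averages. -/

section TentSuperposition

variable {π : Measure ℝ} [IsFiniteMeasure π] {q : ℝ → ℝ}

lemma measurable_tentAvg_uncurry (hq : Continuous q) {C : ℝ} (hC : ∀ x, |q x| ≤ C) :
    Measurable (fun p : ℝ × ℝ => tentAvg p.1 q p.2) :=
  (continuous_tentAvg_uncurry hq hC).measurable

lemma continuous_tentAvg_left (hq : Continuous q) {C : ℝ} (hC : ∀ x, |q x| ≤ C) (x : ℝ) :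
    Continuous (fun z => tentAvg z q x) :=
  (continuous_tentAvg_uncurry hq hC).comp (f := fun z => (z, x)) (by fun_prop)

lemma continuous_tentAvg (hq : Continuous q) {C : ℝ} (hC : ∀ x, |q x| ≤ C) (z : ℝ) :
    Continuous (tentAvg z q) :=
  (continuous_tentAvg_uncurry hq hC).comp (f := fun x => (z, x)) (by fun_prop)

lemma integrable_tentAvg_left (hq : Continuous q) {C : ℝ} (hC : ∀ x, |q x| ≤ C) (x : ℝ)
    (μ : Measure ℝ) [IsFiniteMeasure μ] : Integrable (fun z => tentAvg z q x) μ :=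
  Integrable.of_bound (continuous_tentAvg_left hq hC x).aestronglyMeasurable C
    (ae_of_all _ fun z => abs_tentAvg_le hC z x)

lemma continuous_integral_tentAvg (hq : Continuous q) {C : ℝ} (hC : ∀ x, |q x| ≤ C)
    (μ : Measure ℝ) [IsFiniteMeasure μ] : Continuous (fun x => ∫ z, tentAvg z q x ∂μ) := by
  refine continuous_of_dominated (bound := fun _ => C) (fun x => ?_) (fun x => ?_)
    (integrable_const C) ?_
  · exact (continuous_tentAvg_left hq hC x).aestronglyMeasurable
  · exact ae_of_all _ fun z => abs_tentAvg_le hC z x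
  · exact ae_of_all _ fun z => continuous_tentAvg hq hC z

lemma memLp_integral_tentAvg (hq : Continuous q) {C : ℝ} (hC : ∀ x, |q x| ≤ C)
    (hN : sqNorm q < ⊤) (μ : Measure ℝ) [IsFiniteMeasure μ] :
    MemLp (fun x => ∫ z, tentAvg z q x ∂μ) 2 volume := by
  refine memLp_two_of_sqNorm_lt_top
    (continuous_integral_tentAvg hq hC μ).aestronglyMeasurable ?_
  refine (sqNorm_integral_le' μ (measurable_tentAvg_uncurry hq hC)).trans_lt ?_
  refine ENNReal.mul_lt_top (measure_lt_top _ _) ?_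
  calc ∫⁻ z, sqNorm (tentAvg z q) ∂μ ≤ ∫⁻ _, sqNorm q ∂μ :=
        lintegral_mono fun z => sqNorm_tentAvg_le hq z
    _ < ⊤ := by
        rw [lintegral_const]; exact ENNReal.mul_lt_top hN (measure_lt_top _ _)

/-- Fubini transfers positivity from pairs of scales to pairs of measures. Zero scales are excluded
because `hpos` will be obtained by dividing by z² y²; they form a null set. -/
lemma integral_mul_integral_tentAvg_nonneg (hq : Continuous q) {C : ℝ} (hC : ∀ x, |q x| ≤ C)
    (hN : sqNorm q < ⊤) (hpos : ∀ z y, z ≠ 0 → y ≠ 0 → 0 ≤ ∫ x, tentAvg z q x * tentAvg y q x)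
    (μ μ' : Measure ℝ) [IsFiniteMeasure μ] [IsFiniteMeasure μ'] (hμ : μ {0} = 0)
    (hμ' : μ' {0} = 0) :
    0 ≤ ∫ x, (∫ z, tentAvg z q x ∂μ) * ∫ y, tentAvg y q x ∂μ' := by
  have hc := continuous_tentAvg_uncurry hq hC
  have hint : Integrable (fun p : ℝ × (ℝ × ℝ) => tentAvg p.2.1 q p.1 * tentAvg p.2.2 q p.1)
      (volume.prod (μ.prod μ')) := by
    have hcont : Continuous
        (fun p : ℝ × (ℝ × ℝ) => tentAvg p.2.1 q p.1 * tentAvg p.2.2 q p.1) :=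
      (hc.comp (f := fun p : ℝ × (ℝ × ℝ) => (p.2.1, p.1)) (by fun_prop)).mul
        (hc.comp (f := fun p : ℝ × (ℝ × ℝ) => (p.2.2, p.1)) (by fun_prop))
    refine ⟨hcont.aestronglyMeasurable, ?_⟩
    rw [HasFiniteIntegral, lintegral_prod_symm _ hcont.aestronglyMeasurable.enorm]
    calc ∫⁻ p : ℝ × ℝ, (∫⁻ x, ‖tentAvg p.1 q x * tentAvg p.2 q x‖ₑ) ∂(μ.prod μ')
        ≤ ∫⁻ _ : ℝ × ℝ, (sqNorm q + sqNorm q) ∂(μ.prod μ') := by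
          refine lintegral_mono fun p => ?_
          calc ∫⁻ x, ‖tentAvg p.1 q x * tentAvg p.2 q x‖ₑ
              ≤ ∫⁻ x, (‖tentAvg p.1 q x‖ₑ ^ 2 + ‖tentAvg p.2 q x‖ₑ ^ 2) := by
                refine lintegral_mono fun x => ?_
                rw [enorm_mul]
                rcases le_total ‖tentAvg p.1 q x‖ₑ ‖tentAvg p.2 q x‖ₑ with h | h
                · calc _ ≤ ‖tentAvg p.2 q x‖ₑ * ‖tentAvg p.2 q x‖ₑ := by gcongr
                    _ ≤ _ := by rw [← sq]; exact le_add_self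
                · calc _ ≤ ‖tentAvg p.1 q x‖ₑ * ‖tentAvg p.1 q x‖ₑ := by gcongr
                    _ ≤ _ := by rw [← sq]; exact le_self_add
            _ = sqNorm (tentAvg p.1 q) + sqNorm (tentAvg p.2 q) := by
                rw [lintegral_add_left]
                · rfl
                · exact ((continuous_tentAvg hq hC _).measurable.enorm).pow_const 2
            _ ≤ _ := add_le_add (sqNorm_tentAvg_le hq _) (sqNorm_tentAvg_le hq _)
      _ < ⊤ := by
          rw [lintegral_const]
          exact ENNReal.mul_lt_top (ENNReal.add_lt_top.2 ⟨hN, hN⟩) (measure_lt_top _ _)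
  have h1 : ∀ x, (∫ z, tentAvg z q x ∂μ) * ∫ y, tentAvg y q x ∂μ'
      = ∫ p : ℝ × ℝ, tentAvg p.1 q x * tentAvg p.2 q x ∂(μ.prod μ') := fun x =>
    (integral_prod_mul _ _).symm
  simp_rw [h1]
  rw [integral_integral_swap (f := fun x (p : ℝ × ℝ) => tentAvg p.1 q x * tentAvg p.2 q x) hint]
  refine integral_nonneg_of_ae ?_
  have e1 : ∀ᵐ p ∂(μ.prod μ'), p.1 ≠ 0 :=
    Measure.quasiMeasurePreserving_fst.ae (compl_mem_ae_iff.2 hμ)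
  have e2 : ∀ᵐ p ∂(μ.prod μ'), p.2 ≠ 0 :=
    Measure.quasiMeasurePreserving_snd.ae (compl_mem_ae_iff.2 hμ')
  filter_upwards [e1, e2] with p h1 h2 using hpos _ _ h1 h2

/-- A maximal inequality for the truncations `∫_{|z| ≤ δ} tentAvg z q x dπ(z)`. -/
lemma exists_maximal_tentAvg (hq : Continuous q) {C : ℝ} (hC : ∀ x, |q x| ≤ C)
    (hN : sqNorm q < ⊤) (hpos : ∀ z y, z ≠ 0 → y ≠ 0 → 0 ≤ ∫ x, tentAvg z q x * tentAvg y q x)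
    {K : ℝ} (hK0 : 0 ≤ K) (hK : HasHalfModulus K q) (hπ0 : π {0} = 0) {r : ℝ} (hr : 0 < r)
    (hπr : ∀ᵐ z ∂π, |z| < r) (J : ℕ) :
    ∃ G : ℝ → ENNReal, Measurable G ∧
      ∫⁻ x, G x ≤ ENNReal.ofReal (15 * (J + 1) ^ 2) * sqNorm (fun x => ∫ z, tentAvg z q x ∂π)
        + 12 * (π univ ^ 2 * ENNReal.ofReal (K * (r / 2 ^ J))) ∧
      ∀ᵐ x, ∀ δ : ℝ, 0 < δ → ‖∫ z in Icc (-δ) δ, tentAvg z q x ∂π‖ₑ ^ 2 ≤ G x := by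
  -- Cut |z| < r into 2^J shells of width τ. Whole shells are handled by the maximal inequality for
  -- sums, the shell cut by δ by freezing the scale at its inner radius.
  set τ : ℝ := r / 2 ^ J with hτ
  have hτ0 : 0 < τ := by positivity
  set E : ℕ → Set ℝ := fun i => {z | ⌊|z| / τ⌋₊ = i} with hE
  have hfl : Measurable (fun z : ℝ => ⌊|z| / τ⌋₊) := Nat.measurable_floor.comp (by fun_prop)
  have hEm : ∀ i, MeasurableSet (E i) := fun i => hfl (measurableSet_singleton i)
  have hEd : Pairwise (Function.onFun Disjoint E) := fun i j hij =>
    Set.disjoint_left.2 fun z hz hz' => hij (hz.symm.trans hz')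
  set a : ℕ → ℝ → ℝ := fun i x => ∫ z in E i, tentAvg z q x ∂π with ha
  have hmem : ∀ i, MemLp (a i) 2 volume := fun i => memLp_integral_tentAvg hq hC hN _
  have h0 : ∀ s : Set ℝ, (π.restrict s) {0} = 0 := fun s =>
    le_antisymm ((Measure.restrict_apply_le s {0}).trans hπ0.le) zero_le
  have hapos : ∀ i j, 0 ≤ ∫ x, a i x * a j x := fun i j =>
    integral_mul_integral_tentAvg_nonneg hq hC hN hpos _ _ (h0 _) (h0 _)
  obtain ⟨Q, hQi, hQ0, hQle, hQ⟩ := exists_maximal_partial_sums J hmem hapos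
  -- the total sum
  have hsum : ∀ k x, ∑ i ∈ Finset.range k, a i x
      = ∫ z in {z | ⌊|z| / τ⌋₊ < k}, tentAvg z q x ∂π := by
    intro k x
    have : {z : ℝ | ⌊|z| / τ⌋₊ < k} = ⋃ i ∈ Finset.range k, E i := by
      ext z; simp [hE]
    rw [this, integral_biUnion_finset _ (fun i _ => hEm i) (fun i _ j _ hij => hEd hij)
      (fun i _ => integrable_tentAvg_left hq hC x _)]
  have hlt : ∀ᵐ z ∂π, ⌊|z| / τ⌋₊ < 2 ^ J := by
    filter_upwards [hπr] with z hz
    rw [Nat.floor_lt (by positivity), div_lt_iff₀ hτ0]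
    push_cast
    rw [hτ, mul_div_cancel₀ _ (by positivity)]
    exact hz
  have htot : ∀ x, ∑ i ∈ Finset.range (2 ^ J), a i x = ∫ z, tentAvg z q x ∂π := by
    intro x
    rw [hsum, Measure.restrict_eq_self_of_ae_mem (s := {z | ⌊|z| / τ⌋₊ < 2 ^ J}) hlt]
  -- the discretisation error
  set Φ : ℝ → ℝ → ℝ := fun z x => tentAvg z q x - tentAvg (τ * ⌊|z| / τ⌋₊) q x with hΦ
  have hcu := measurable_tentAvg_uncurry hq hC
  have hΦm : Measurable (fun p : ℝ × ℝ => Φ p.1 p.2) := by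
    refine hcu.sub (hcu.comp (g := fun p : ℝ × ℝ => tentAvg p.1 q p.2)
      (f := fun p : ℝ × ℝ => (τ * (⌊|p.1| / τ⌋₊ : ℝ), p.2)) ?_)
    exact (((measurable_from_top (f := fun n : ℕ => (n : ℝ))).comp
      (hfl.comp measurable_fst)).const_mul τ).prodMk measurable_snd
  have hΦN : ∀ z, sqNorm (Φ z) ≤ ENNReal.ofReal (K * τ) := by
    intro z
    have : Φ z = fun x => tentAvg |z| q x - tentAvg (τ * ⌊|z| / τ⌋₊) q x := by
      ext x; simp only [hΦ, tentAvg_abs hq]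
    rw [this]
    refine (hK.sqNorm_tentAvg_sub_le hK0 hq _ _).trans (ENNReal.ofReal_le_ofReal ?_)
    refine mul_le_mul_of_nonneg_left ?_ hK0
    have h1 := Nat.floor_le (show 0 ≤ |z| / τ by positivity)
    have h2 := Nat.lt_floor_add_one (|z| / τ)
    have h3 : |z| = τ * (|z| / τ) := by field_simp
    rw [abs_le]
    constructor <;> nlinarith
  set H : ℝ → ENNReal := fun x => ∫⁻ z, ‖Φ z x‖ₑ ∂π with hH
  have hHm : Measurable H := Measurable.lintegral_prod_left' (f := fun p : ℝ × ℝ => ‖Φ p.1 p.2‖ₑ)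
    hΦm.enorm
  have hHle : ∫⁻ x, H x ^ 2 ≤ π univ ^ 2 * ENNReal.ofReal (K * τ) := by
    refine (sqNorm_integral_le π hΦm).trans ?_
    calc π univ * ∫⁻ z, sqNorm (Φ z) ∂π ≤ π univ * ∫⁻ _, ENNReal.ofReal (K * τ) ∂π := by
          gcongr with z; exact hΦN z
      _ = _ := by rw [lintegral_const, sq]; ring
  -- `Q` is only almost everywhere measurable, whereas `G` must be measurable.
  set Q' : ℝ → ℝ := hQi.aestronglyMeasurable.mk Q
  have hQ'm : Measurable Q' := hQi.aestronglyMeasurable.stronglyMeasurable_mk.measurable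
  have hQ'e : Q =ᵐ[volume] Q' := hQi.aestronglyMeasurable.ae_eq_mk
  refine ⟨fun x => ENNReal.ofReal (15 * (J + 1) * Q' x) + 12 * H x ^ 2, ?_, ?_, ?_⟩
  · exact (by fun_prop : Measurable fun x => ENNReal.ofReal (15 * (J + 1) * Q' x)).add
      ((hHm.pow_const 2).const_mul 12)
  · rw [lintegral_add_right _ ((hHm.pow_const 2).const_mul 12), lintegral_const_mul _
      (hHm.pow_const 2)]
    refine add_le_add ?_ (by gcongr)
    have e1 : ∫⁻ x, ENNReal.ofReal (15 * (J + 1) * Q' x)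
        = ∫⁻ x, ENNReal.ofReal (15 * (J + 1) * Q x) := by
      refine lintegral_congr_ae ?_
      filter_upwards [hQ'e] with x hx
      rw [hx]
    rw [e1, ← ofReal_integral_eq_lintegral_ofReal (hQi.const_mul _)
      (ae_of_all _ fun x => mul_nonneg (by positivity) (hQ0 x)), integral_const_mul,
      sqNorm_eq_ofReal (memLp_integral_tentAvg hq hC hN π), ← ENNReal.ofReal_mul (by positivity)]
    refine ENNReal.ofReal_le_ofReal ?_
    simp_rw [htot] at hQle
    calc 15 * ((J : ℝ) + 1) * ∫ x, Q x
        ≤ 15 * (J + 1) * ((J + 1) * ∫ x, (∫ z, tentAvg z q x ∂π) ^ 2) := by gcongr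
      _ = _ := by ring
  · filter_upwards [hQ'e] with x hx δ hδ
    rw [← hx]
    -- The index of the shell that contains the radius δ.
    set k := ⌊δ / τ⌋₊ with hk
    have hle : ∀ z ∈ Icc (-δ) δ, ⌊|z| / τ⌋₊ ≤ k := fun z hz =>
      Nat.floor_le_floor (by gcongr; exact abs_le.2 hz)
    have hint := fun s => integrable_tentAvg_left hq hC x (π.restrict s)
    have hQpos : 0 ≤ 15 * ((J : ℝ) + 1) * Q x := mul_nonneg (by positivity) (hQ0 x)
    rcases le_or_gt (2 ^ J) k with hkJ | hkJ
    · -- the truncation is the full integral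
      have hall : ∀ᵐ z ∂π, z ∈ Icc (-δ) δ := by
        filter_upwards [hπr] with z hz
        have h1 : (2 ^ J : ℝ) ≤ δ / τ := by
          have := Nat.floor_le (show 0 ≤ δ / τ by positivity)
          have h2 : ((2 ^ J : ℕ) : ℝ) ≤ k := by exact_mod_cast hkJ
          push_cast at h2
          exact h2.trans this
        rw [le_div_iff₀ hτ0, hτ, mul_div_cancel₀ _ (by positivity)] at h1
        exact abs_le.1 (hz.le.trans h1)
      rw [Measure.restrict_eq_self_of_ae_mem hall, ← htot, ← enorm_pow,
        Real.enorm_of_nonneg (sq_nonneg _)]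
      refine le_trans (ENNReal.ofReal_le_ofReal ?_) le_self_add
      have := hQ x _ le_rfl
      nlinarith [hQ0 x, mul_nonneg (show (0 : ℝ) ≤ J + 1 by positivity) (hQ0 x)]
    · set P := ∑ i ∈ Finset.range k, a i x with hP
      set P' := ∑ i ∈ Finset.range (k + 1), a i x with hP'
      have hPQ := hQ x k hkJ.le
      have hPQ' := hQ x (k + 1) hkJ
      have hH_real : ∀ s : Set ℝ, MeasurableSet s →
          ENNReal.ofReal |∫ z in s, Φ z x ∂π| ≤ H x := by
        intro s hs
        rw [← Real.norm_eq_abs, ofReal_norm]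
        exact (enorm_integral_le_lintegral_enorm _).trans (setLIntegral_le_lintegral _ _)
      have hP'P : a k x = P' - P := by
        rw [hP', Finset.sum_range_succ]; ring
      -- decompose the truncated integral
      have hsplit : ∫ z in Icc (-δ) δ, tentAvg z q x ∂π
          = P + ∫ z in Icc (-δ) δ ∩ E k, tentAvg z q x ∂π := by
        have hset : Icc (-δ) δ = {z | ⌊|z| / τ⌋₊ < k} ∪ (Icc (-δ) δ ∩ E k) := by
          ext z
          constructor
          · intro hz
            rcases (hle z hz).lt_or_eq with h | h
            · exact Or.inl h
            · exact Or.inr ⟨hz, h⟩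
          · rintro (h | h)
            · have h1 : |z| / τ < δ / τ := by
                have h2 := Nat.lt_floor_add_one (|z| / τ)
                have h3 := Nat.floor_le (show 0 ≤ δ / τ by positivity)
                have h4 : ((⌊|z| / τ⌋₊ + 1 : ℕ) : ℝ) ≤ k := by
                  exact_mod_cast (show ⌊|z| / τ⌋₊ < k from h)
                push_cast at h4
                linarith
              exact abs_le.1 ((div_lt_div_iff_of_pos_right hτ0).1 h1).le
            · exact h.1
        conv_lhs => rw [hset]
        rw [setIntegral_union _ (measurableSet_Icc.inter (hEm k)) (hint _) (hint _), hP, hsum]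
        exact Set.disjoint_left.2 fun z hz hz' => hz.ne hz'.2
      -- Up to the discretisation error, a piece of shell `k` contributes its mass times one frozen
      -- value, hence no more in absolute value than the whole shell.
      have hpart : ∀ s : Set ℝ, MeasurableSet s → s ⊆ E k → ∫ z in s, tentAvg z q x ∂π
          = π.real s * tentAvg (τ * k) q x + ∫ z in s, Φ z x ∂π := by
        intro s hs hsE
        have : ∫ z in s, Φ z x ∂π = ∫ z in s, (tentAvg z q x - tentAvg (τ * k) q x) ∂π := by
          refine setIntegral_congr_fun hs fun z hz => ?_
          have := hsE hz
          simp only [hE, mem_ofPred_eq] at this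
          simp only [hΦ, this]
        rw [this, integral_sub (hint _) (integrable_const _)]
        simp
      set c := tentAvg (τ * k) q x
      set S := Icc (-δ) δ ∩ E k
      have hSE : S ⊆ E k := inter_subset_right
      have hSm : MeasurableSet S := measurableSet_Icc.inter (hEm k)
      have hb1 := hpart S hSm hSE
      have hb2 : a k x = _ := hpart (E k) (hEm k) subset_rfl
      set eS := ∫ z in S, Φ z x ∂π
      set eE := ∫ z in E k, Φ z x ∂π
      have hmono : π.real S ≤ π.real (E k) := measureReal_mono hSE
      have hnn : 0 ≤ π.real S := measureReal_nonneg
      have hSc : |π.real S * c| ≤ |a k x - eE| := by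
        rw [hb2, add_sub_cancel_right, abs_mul, abs_mul]
        gcongr
      have hbound : |∫ z in Icc (-δ) δ, tentAvg z q x ∂π| ≤ |P'| + 2 * |P| + (|eS| + |eE|) := by
        rw [hsplit, hb1]
        rw [hP'P] at hSc
        have t1 := abs_add_le P (π.real S * c + eS)
        have t2 := abs_add_le (π.real S * c) eS
        have t3 := abs_sub (P' - P) eE
        have t4 := abs_sub P' P
        linarith
      -- From (a + b + c)² ≤ 3(a² + b² + c²): 15 = 3(1 + 4), and 12 = 3 · 4 because each of the two
      -- errors is at most `H x`.
      have hsq : (∫ z in Icc (-δ) δ, tentAvg z q x ∂π) ^ 2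
          ≤ 15 * (J + 1) * Q x + 12 * (((|eS| + |eE|) / 2) ^ 2) := by
        rw [← sq_abs]
        have hp : |P| ^ 2 ≤ (J + 1) * Q x := by rw [sq_abs]; exact hPQ
        have hp' : |P'| ^ 2 ≤ (J + 1) * Q x := by rw [sq_abs]; exact hPQ'
        calc _ ≤ (|P'| + 2 * |P| + (|eS| + |eE|)) ^ 2 := by gcongr
          _ ≤ 3 * (|P'| ^ 2 + (2 * |P|) ^ 2 + (|eS| + |eE|) ^ 2) := by
              nlinarith [sq_nonneg (|P'| - 2 * |P|), sq_nonneg (|P'| - (|eS| + |eE|)),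
                sq_nonneg (2 * |P| - (|eS| + |eE|))]
          _ ≤ _ := by nlinarith
      rw [← enorm_pow, Real.enorm_of_nonneg (sq_nonneg _)]
      refine (ENNReal.ofReal_le_ofReal hsq).trans ?_
      rw [ENNReal.ofReal_add hQpos (by positivity),
        ENNReal.ofReal_mul (p := 12) (by norm_num), ENNReal.ofReal_pow (by positivity)]
      gcongr
      · simp
      · rw [ENNReal.ofReal_div_of_pos (by norm_num), ENNReal.ofReal_add (abs_nonneg _)
          (abs_nonneg _)]
        refine ENNReal.div_le_of_le_mul ?_
        have := add_le_add (hH_real S hSm) (hH_real (E k) (hEm k))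
        rw [show ENNReal.ofReal 2 = 2 by simp, mul_two]
        exact this

end TentSuperposition

/-! ### Lévy measures, truncation and symmetrisation. -/

/-- The measure `z² dν(z)`. -/
noncomputable def sqWeighted (ν : Measure ℝ) : Measure ℝ :=
  ν.withDensity (fun z => ENNReal.ofReal (z ^ 2))

section LevyMeasure

variable {ν : Measure ℝ} {r₀ : ℝ}

lemma ae_abs_lt_of_support (hsupp : ν.support ⊆ Ioo (-r₀) r₀) : ∀ᵐ z ∂ν, |z| < r₀ := by
  filter_upwards [Measure.support_mem_ae] with z hz using abs_lt.2 (hsupp hz)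

lemma sqWeighted_absolutelyContinuous (ν : Measure ℝ) : sqWeighted ν ≪ ν :=
  withDensity_absolutelyContinuous _ _

lemma isFiniteMeasure_sqWeighted (hν : IsSymmDiffuseLevy ν)
    (hsupp : ν.support ⊆ Ioo (-r₀) r₀) : IsFiniteMeasure (sqWeighted ν) := by
  refine ⟨?_⟩
  rw [sqWeighted, withDensity_apply _ MeasurableSet.univ, Measure.restrict_univ]
  calc ∫⁻ z, ENNReal.ofReal (z ^ 2) ∂ν
      -- On |z| < r₀ one has z² ≤ (1 + r₀²) min(1, z²).
      ≤ ∫⁻ z, ENNReal.ofReal (1 + r₀ ^ 2) * ENNReal.ofReal (min 1 (z ^ 2)) ∂ν := by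
        refine lintegral_mono_ae ?_
        filter_upwards [ae_abs_lt_of_support hsupp] with z hz
        rw [← ENNReal.ofReal_mul (by positivity)]
        refine ENNReal.ofReal_le_ofReal ?_
        have h1 : z ^ 2 ≤ r₀ ^ 2 := sq_le_sq' (by linarith [(abs_lt.1 hz).1]) (abs_lt.1 hz).2.le
        rcases le_total 1 (z ^ 2) with h | h
        · rw [min_eq_left h]; linarith
        · rw [min_eq_right h]; nlinarith [sq_nonneg z, sq_nonneg r₀]
    _ < ⊤ := by
        rw [lintegral_const_mul' _ _ ENNReal.ofReal_ne_top]
        exact ENNReal.mul_lt_top ENNReal.ofReal_lt_top hν.lintegral_lt_top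

/-- Markov's inequality for min(1, z²), which exceeds a positive constant away from the origin. -/
lemma isFiniteMeasure_levyTrunc (hν : IsSymmDiffuseLevy ν) {δ : ℝ} (hδ : 0 < δ) :
    IsFiniteMeasure (levyTrunc ν δ) := by
  refine ⟨?_⟩
  rw [levyTrunc, Measure.restrict_apply_univ]
  have h := meas_ge_le_lintegral_div (μ := ν) (f := fun z => ENNReal.ofReal (min 1 (z ^ 2)))
    (by fun_prop) (ε := ENNReal.ofReal (min 1 (δ ^ 2))) (by simp; positivity) (by simp)
  refine (measure_mono ?_).trans_lt (h.trans_lt (ENNReal.div_lt_top hν.lintegral_lt_top.ne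
    (by simp; positivity)))
  intro z hz
  refine ENNReal.ofReal_le_ofReal (min_le_min_left _ ?_)
  have : δ < |z| := by
    by_contra hc
    exact hz (abs_le.1 (not_lt.1 hc))
  rw [← sq_abs z]
  gcongr

lemma map_neg_levyTrunc (hν : IsSymmDiffuseLevy ν) (δ : ℝ) :
    (levyTrunc ν δ).map (fun z => -z) = levyTrunc ν δ := by
  have hme : MeasurableEmbedding (fun z : ℝ => -z) := (MeasurableEquiv.neg ℝ).measurableEmbedding
  conv_rhs => rw [levyTrunc, ← hν.symm, hme.restrict_map]
  rw [levyTrunc]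
  congr 2
  ext z
  simp only [mem_compl_iff, mem_Icc, mem_preimage]
  constructor <;> intro h hc <;> exact h ⟨by linarith [hc.1, hc.2], by linarith [hc.1, hc.2]⟩

lemma integrable_translate {u : ℝ → ℝ} (hu : Measurable u) {C : ℝ} (hC : ∀ x, |u x| ≤ C)
    (μ : Measure ℝ) [IsFiniteMeasure μ] (x : ℝ) : Integrable (fun z => u (x + z)) μ :=
  Integrable.of_bound (Measurable.aestronglyMeasurable (by fun_prop)) C (ae_of_all _ fun z => hC _)

/-- Average the integral with its image under z ↦ -z. Only the second difference survives, and for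
tent averages it absorbs the singularity of ν. -/
lemma integral_diff_levyTrunc (hν : IsSymmDiffuseLevy ν) {u : ℝ → ℝ} (hu : Measurable u) {C : ℝ}
    (hC : ∀ x, |u x| ≤ C) {δ : ℝ} (hδ : 0 < δ) (x : ℝ) :
    ∫ z, (u (x + z) - u x) ∂(levyTrunc ν δ)
      = 2⁻¹ * ∫ z, secondDiff z u x ∂(levyTrunc ν δ) := by
  have := isFiniteMeasure_levyTrunc hν hδ
  have i1 := integrable_translate hu hC (levyTrunc ν δ) x
  have i1' : Integrable (fun z => u (x + z) - u x) (levyTrunc ν δ) := i1.sub (integrable_const _)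
  have e : ∫ z, (u (x + z) - u x) ∂(levyTrunc ν δ)
      = ∫ z, (u (x + -z) - u x) ∂(levyTrunc ν δ) := by
    conv_lhs => rw [← map_neg_levyTrunc hν δ]
    rw [integral_map (by fun_prop) (Measurable.aestronglyMeasurable (by fun_prop))]
  have i2' : Integrable (fun z => u (x + -z) - u x) (levyTrunc ν δ) := by
    refine Integrable.sub ?_ (integrable_const _)
    exact Integrable.of_bound (Measurable.aestronglyMeasurable (by fun_prop)) C (ae_of_all _ fun z => hC _)
  have : ∫ z, secondDiff z u x ∂(levyTrunc ν δ)
      = ∫ z, (u (x + z) - u x) ∂(levyTrunc ν δ) + ∫ z, (u (x + -z) - u x) ∂(levyTrunc ν δ) := by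
    rw [← integral_add i1' i2']
    congr 1; ext z; simp only [secondDiff]; ring_nf
  rw [this, ← e]; ring

lemma setIntegral_sqWeighted {s : Set ℝ} (hs : MeasurableSet s) (φ : ℝ → ℝ) :
    ∫ z in s, φ z ∂(sqWeighted ν) = ∫ z in s, z ^ 2 * φ z ∂ν := by
  rw [sqWeighted, setIntegral_withDensity_eq_setIntegral_toReal_smul (by fun_prop)
    (ae_of_all _ fun _ => ENNReal.ofReal_lt_top) _ hs]
  refine setIntegral_congr_fun hs fun z _ => ?_
  simp only [ENNReal.toReal_ofReal (sq_nonneg z), smul_eq_mul]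

lemma integral_diff_levyTrunc_eq_sqWeighted (hν : IsSymmDiffuseLevy ν) {u : ℝ → ℝ}
    (hu : Measurable u) {C : ℝ} (hC : ∀ x, |u x| ≤ C) {φ : ℝ → ℝ} {x : ℝ}
    (hφ : ∀ z, secondDiff z u x = z ^ 2 * φ z) {δ : ℝ} (hδ : 0 < δ) :
    ∫ z, (u (x + z) - u x) ∂(levyTrunc ν δ)
      = 2⁻¹ * ∫ z in (Icc (-δ) δ)ᶜ, φ z ∂(sqWeighted ν) := by
  rw [integral_diff_levyTrunc hν hu hC hδ, setIntegral_sqWeighted measurableSet_Icc.compl]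
  simp_rw [hφ, levyTrunc]

/-- Once the integrand is integrable against z² dν, the principal value is an ordinary integral. -/
lemma tendsto_setIntegral_compl_Icc {π : Measure ℝ} (hπ0 : π {0} = 0) {φ : ℝ → ℝ}
    (hφ : Integrable φ π) :
    Tendsto (fun δ : ℝ => ∫ z in (Icc (-δ) δ)ᶜ, φ z ∂π) (𝓝[>] 0) (𝓝 (∫ z, φ z ∂π)) := by
  simp_rw [← integral_indicator measurableSet_Icc.compl]
  refine tendsto_integral_filter_of_dominated_convergence (fun z => ‖φ z‖) ?_ ?_ hφ.norm ?_
  · exact Eventually.of_forall fun δ => hφ.aestronglyMeasurable.indicator measurableSet_Icc.compl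
  · exact Eventually.of_forall fun δ => ae_of_all _ fun z => norm_indicator_le_norm_self _ _
  · have : ∀ᵐ z ∂π, z ≠ 0 := compl_mem_ae_iff.2 hπ0
    filter_upwards [this] with z hz
    refine tendsto_const_nhds.congr' ?_
    have : ∀ᶠ δ : ℝ in 𝓝[>] 0, δ < |z| :=
      nhdsWithin_le_nhds (Iio_mem_nhds (abs_pos.2 hz))
    filter_upwards [this] with δ hδ
    rw [indicator_of_mem]
    exact fun hc => (not_le.2 hδ) (abs_le.2 hc)

end LevyMeasure

/-! ### Stability of the half-order modulus. -/

section HalfModulus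

variable {u v : ℝ → ℝ} {K K' : ℝ}

lemma HasHalfModulus.add (hu : HasHalfModulus K u) (hv : HasHalfModulus K' v) (hum : Measurable u)
    (hK : 0 ≤ K) (hK' : 0 ≤ K') :
    HasHalfModulus (2 * K + 2 * K') (fun x => u x + v x) := by
  intro a b
  have : ∀ x, u (x + a) + v (x + a) - (u (x + b) + v (x + b))
      = (u (x + a) - u (x + b)) + (v (x + a) - v (x + b)) := fun x => by ring
  simp_rw [this]
  refine (sqNorm_add_le (by fun_prop)).trans ?_
  refine (add_le_add (mul_le_mul_right (hu a b) 2) (mul_le_mul_right (hv a b) 2)).trans ?_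
  rw [show (2 : ENNReal) = ENNReal.ofReal 2 by simp, ← ENNReal.ofReal_mul (by norm_num),
    ← ENNReal.ofReal_mul (by norm_num), ← ENNReal.ofReal_add (by positivity) (by positivity)]
  exact (congrArg _ (by ring)).le

lemma HasHalfModulus.const_mul (hu : HasHalfModulus K u) (c : ℝ) :
    HasHalfModulus (c ^ 2 * K) (fun x => c * u x) := by
  intro a b
  simp_rw [← mul_sub]
  rw [sqNorm_const_mul, mul_assoc, ENNReal.ofReal_mul (sq_nonneg c)]
  gcongr
  exact hu a b

lemma HasHalfModulus.comp_add (hu : HasHalfModulus K u) (c : ℝ) :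
    HasHalfModulus K (fun x => u (x + c)) := by
  intro a b
  have := hu (a + c) (b + c)
  simpa only [add_assoc, add_sub_add_right_eq_sub] using this

lemma HasHalfModulus.secondDiff (hu : HasHalfModulus K u) (hum : Measurable u) (hK : 0 ≤ K)
    (h : ℝ) : HasHalfModulus (16 * K) (secondDiff h u) := by
  -- The sum of the two translates has constant 4K, as does -2u; adding them gives 2 · 4K + 2 · 4K =
  -- 16K.
  have h1 := ((hu.comp_add h).add (hu.comp_add (-h)) (by fun_prop) hK hK).add (hu.const_mul (-2))
    (by fun_prop) (by positivity) (by positivity)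
  convert h1 using 1
  · ring
  · ext x; simp only [_root_.secondDiff]; ring_nf

/-- A second difference is a sum of two increments, each in L² even when `u` is not. -/
lemma HasHalfModulus.sqNorm_secondDiff_lt_top (hu : HasHalfModulus K u) (hum : Measurable u)
    (h : ℝ) : sqNorm (_root_.secondDiff h u) < ⊤ := by
  have : _root_.secondDiff h u
      = fun x => (u (x + h) - u (x + 0)) + (u (x + -h) - u (x + 0)) := by
    ext x; simp only [_root_.secondDiff, add_zero]; ring_nf
  rw [this]
  refine (sqNorm_add_le (by fun_prop)).trans_lt ?_
  refine ENNReal.add_lt_top.2 ⟨ENNReal.mul_lt_top (by simp) ?_, ENNReal.mul_lt_top (by simp) ?_⟩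
  · exact (hu _ _).trans_lt ENNReal.ofReal_lt_top
  · exact (hu _ _).trans_lt ENNReal.ofReal_lt_top

end HalfModulus

/-! ### Principal values almost everywhere. -/

lemma abs_secondDiff_le {u : ℝ → ℝ} {C : ℝ} (hC : ∀ x, |u x| ≤ C) (h x : ℝ) :
    |secondDiff h u x| ≤ 4 * C := by
  have h1 := abs_le.1 (hC (x + h))
  have h2 := abs_le.1 (hC (x - h))
  have h3 := abs_le.1 (hC x)
  rw [secondDiff, abs_le]
  constructor <;> linarith [h1.1, h1.2, h2.1, h2.2, h3.1, h3.2]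

lemma tentAvg_add_smul {u v : ℝ → ℝ} (hu : Continuous u) (hv : Continuous v) (a b z x : ℝ) :
    tentAvg z (fun y => a * u y + b * v y) x = a * tentAvg z u x + b * tentAvg z v x := by
  simp only [tentAvg]
  rw [integral_add (integrable_tent (by fun_prop)) (integrable_tent (by fun_prop)),
    integral_const_mul, integral_const_mul]

/-- The difference of two tent averages at scales `h` and `k`: its second differences are
tent averages of the function `q`. -/
lemma secondDiff_tentAvg_sub {w : ℝ → ℝ} (hw : Continuous w) {h k : ℝ} (hh : h ≠ 0) (hk : k ≠ 0)
    (z x : ℝ) :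
    secondDiff z (fun y => tentAvg h w y - tentAvg k w y) x
      = z ^ 2 * tentAvg z (fun y => (h ^ 2)⁻¹ * secondDiff h w y
        + (-(k ^ 2)⁻¹) * secondDiff k w y) x := by
  rw [tentAvg_add_smul (continuous_secondDiff hw h) (continuous_secondDiff hw k)]
  have h1 := secondDiff_tentAvg hw z x hh
  have h2 := secondDiff_tentAvg hw z x hk
  have : secondDiff z (fun y => tentAvg h w y - tentAvg k w y) x
      = secondDiff z (tentAvg h w) x - secondDiff z (tentAvg k w) x := by
    simp only [secondDiff]; ring
  rw [this, h1, h2]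
  ring

/-- The maximal function of the truncated operators applied to the difference of two tent averages
is square integrable, with a quantitative bound. -/
lemma exists_maximal_levyTrunc {ν : Measure ℝ} {r₀ : ℝ} (hν : IsSymmDiffuseLevy ν) (hr₀ : 0 < r₀)
    (hsupp : ν.support ⊆ Ioo (-r₀) r₀) {w F : ℝ → ℝ} (hw : Continuous w) {C : ℝ}
    (hC : ∀ x, |w x| ≤ C) {K : ℝ} (hK0 : 0 ≤ K) (hwK : HasHalfModulus K w) (hF : Continuous F)
    (hFK : HasHalfModulus K F)
    (heq : ∀ h, h ≠ 0 → ∀ x,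
      ∫ z, tentAvg z (secondDiff h w) x ∂(sqWeighted ν) = -2 * h ^ 2 * tentAvg h F x)
    {h k : ℝ} (hh : h ≠ 0) (hk : k ≠ 0) (J : ℕ) :
    ∃ G : ℝ → ENNReal, Measurable G ∧
      ∫⁻ x, G x ≤ ENNReal.ofReal (16 * (J + 1) ^ 2 * (4 * K * |h - k|)
          + 12 * ((sqWeighted ν).real univ ^ 2
            * ((32 * (h ^ 2)⁻¹ ^ 2 * K + 32 * (k ^ 2)⁻¹ ^ 2 * K) * (r₀ / 2 ^ J)))) ∧
      ∀ᵐ x, ∀ δ : ℝ, 0 < δ →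
        ‖∫ z, ((tentAvg h w (x + z) - tentAvg k w (x + z)) - (tentAvg h w x - tentAvg k w x))
          ∂(levyTrunc ν δ)‖ₑ ^ 2 ≤ G x := by
  set π := sqWeighted ν with hπ
  have hfin : IsFiniteMeasure π := isFiniteMeasure_sqWeighted hν hsupp
  have hπ0 : π {0} = 0 := sqWeighted_absolutelyContinuous ν hν.zero
  have hπr : ∀ᵐ z ∂π, |z| < r₀ :=
    (sqWeighted_absolutelyContinuous ν).ae_le (ae_abs_lt_of_support hsupp)
  set v : ℝ → ℝ := fun y => tentAvg h w y - tentAvg k w y with hv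
  set q : ℝ → ℝ := fun y => (h ^ 2)⁻¹ * secondDiff h w y + (-(k ^ 2)⁻¹) * secondDiff k w y with hq
  have hch := continuous_secondDiff hw h
  have hck := continuous_secondDiff hw k
  have hqc : Continuous q := by fun_prop
  have hvc : Continuous v := (continuous_tentAvg hw hC h).sub (continuous_tentAvg hw hC k)
  have hsd : ∀ z x, secondDiff z v x = z ^ 2 * tentAvg z q x := fun z x =>
    secondDiff_tentAvg_sub hw hh hk z x
  have hqC : ∀ x, |q x| ≤ (h ^ 2)⁻¹ * (4 * C) + (k ^ 2)⁻¹ * (4 * C) := by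
    intro x
    refine (abs_add_le _ _).trans (add_le_add ?_ ?_)
    · rw [abs_mul, abs_of_nonneg (by positivity)]
      gcongr; exact abs_secondDiff_le hC h x
    · rw [abs_mul, abs_neg, abs_of_nonneg (by positivity)]
      gcongr; exact abs_secondDiff_le hC k x
  have hvC : ∀ x, |v x| ≤ C + C := fun x =>
    (abs_sub _ _).trans (add_le_add (abs_tentAvg_le hC h x) (abs_tentAvg_le hC k x))
  have hqN : sqNorm q < ⊤ := by
    refine (sqNorm_add_le (by fun_prop)).trans_lt ?_
    rw [sqNorm_const_mul, sqNorm_const_mul]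
    have a1 := hwK.sqNorm_secondDiff_lt_top hw.measurable h
    have a2 := hwK.sqNorm_secondDiff_lt_top hw.measurable k
    exact ENNReal.add_lt_top.2
      ⟨ENNReal.mul_lt_top (by simp) (ENNReal.mul_lt_top ENNReal.ofReal_lt_top a1),
        ENNReal.mul_lt_top (by simp) (ENNReal.mul_lt_top ENNReal.ofReal_lt_top a2)⟩
  have hqK : HasHalfModulus (32 * (h ^ 2)⁻¹ ^ 2 * K + 32 * (k ^ 2)⁻¹ ^ 2 * K) q := by
    have := ((hwK.secondDiff hw.measurable hK0 h).const_mul (h ^ 2)⁻¹).add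
      ((hwK.secondDiff hw.measurable hK0 k).const_mul (-(k ^ 2)⁻¹)) (by fun_prop)
      (by positivity) (by positivity)
    convert this using 1
    ring
  -- `w` itself need not be in L²; the difference of two of its averages is, and positivity of
  -- second differences is applied to it.
  have hvL : MemLp v 2 volume :=
    memLp_two_of_sqNorm_lt_top hvc.aestronglyMeasurable
      ((hwK.sqNorm_tentAvg_sub_le hK0 hw h k).trans_lt ENNReal.ofReal_lt_top)
  have hpos : ∀ z y, z ≠ 0 → y ≠ 0 → 0 ≤ ∫ x, tentAvg z q x * tentAvg y q x := by
    intro z y hz hy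
    have h1 := integral_secondDiff_mul_secondDiff_nonneg hvL z y
    simp_rw [hsd] at h1
    have h2 : ∀ x, z ^ 2 * tentAvg z q x * (y ^ 2 * tentAvg y q x)
        = (z ^ 2 * y ^ 2) * (tentAvg z q x * tentAvg y q x) := fun x => by ring
    simp_rw [h2, integral_const_mul] at h1
    exact nonneg_of_mul_nonneg_right h1 (by positivity)
  obtain ⟨G, hGm, hGle, hG⟩ := exists_maximal_tentAvg (π := π) hqc hqC hqN hpos
    (by positivity) hqK hπ0 hr₀ hπr J
  set f : ℝ → ℝ := fun x => ∫ z, tentAvg z q x ∂π with hf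
  have hfc : Continuous f := continuous_integral_tentAvg hqc hqC π
  -- The equation identifies the untruncated integral, and the modulus of `F` then makes it small
  -- with `|h - k|`.
  have hfF : ∀ x, f x = -2 * (tentAvg h F x - tentAvg k F x) := by
    intro x
    have h1 : ∀ z, tentAvg z q x = (h ^ 2)⁻¹ * tentAvg z (secondDiff h w) x
        + (-(k ^ 2)⁻¹) * tentAvg z (secondDiff k w) x := fun z => tentAvg_add_smul hch hck _ _ _ _
    simp only [hf, h1]
    rw [integral_add ((integrable_tentAvg_left hch (abs_secondDiff_le hC h) x π).const_mul _)
      ((integrable_tentAvg_left hck (abs_secondDiff_le hC k) x π).const_mul _),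
      integral_const_mul, integral_const_mul, heq h hh, heq k hk]
    field_simp
    ring
  have hfN : sqNorm f ≤ ENNReal.ofReal (4 * K * |h - k|) := by
    simp_rw [show f = fun x => -2 * (tentAvg h F x - tentAvg k F x) from funext hfF]
    rw [sqNorm_const_mul, mul_assoc, ENNReal.ofReal_mul (by norm_num)]
    norm_num
    gcongr
    exact hFK.sqNorm_tentAvg_sub_le hK0 hF h k
  refine ⟨fun x => G x + ‖f x‖ₑ ^ 2, hGm.add (hfc.measurable.enorm.pow_const 2), ?_, ?_⟩
  · rw [lintegral_add_left hGm]
    change (∫⁻ x, G x) + sqNorm f ≤ _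
    refine (add_le_add_left hGle _).trans ?_
    have hu : π univ = ENNReal.ofReal (π.real univ) := by simp
    have h12 : (12 : ENNReal) = ENNReal.ofReal 12 := by simp
    calc _ ≤ (ENNReal.ofReal (15 * (J + 1) ^ 2) * ENNReal.ofReal (4 * K * |h - k|)
          + 12 * (π univ ^ 2 * ENNReal.ofReal ((32 * (h ^ 2)⁻¹ ^ 2 * K
            + 32 * (k ^ 2)⁻¹ ^ 2 * K) * (r₀ / 2 ^ J))))
          + ENNReal.ofReal (1 * (J + 1) ^ 2) * ENNReal.ofReal (4 * K * |h - k|) := by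
          refine add_le_add (add_le_add_left (by gcongr) _) ?_
          refine hfN.trans (le_mul_of_one_le_left zero_le ?_)
          rw [one_mul, ENNReal.one_le_ofReal]
          exact one_le_pow₀ (by linarith [(Nat.cast_nonneg J : (0 : ℝ) ≤ J)])
      _ = _ := by
          rw [hu, h12, ← ENNReal.ofReal_pow (by positivity), ← ENNReal.ofReal_mul (by positivity),
            ← ENNReal.ofReal_mul (by positivity), ← ENNReal.ofReal_mul (by positivity),
            ← ENNReal.ofReal_mul (by positivity), ← ENNReal.ofReal_add (by positivity)
            (by positivity), ← ENNReal.ofReal_add (by positivity) (by positivity)]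
          congr 1
          ring
  · filter_upwards [hG] with x hx δ hδ
    have hI := integral_diff_levyTrunc_eq_sqWeighted hν hvc.measurable hvC (φ := fun z => tentAvg z q x)
      (x := x) (fun z => hsd z x) hδ
    change ‖∫ z, (v (x + z) - v x) ∂(levyTrunc ν δ)‖ₑ ^ 2 ≤ _
    rw [hI]
    have hcompl := integral_add_compl (μ := π) (measurableSet_Icc (a := -δ) (b := δ))
      (integrable_tentAvg_left hqc hqC x π)
    set A := ∫ z in Icc (-δ) δ, tentAvg z q x ∂π
    set B := ∫ z in (Icc (-δ) δ)ᶜ, tentAvg z q x ∂π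
    -- The truncated operator is (f - A)/2, whose square is at most f² + A². The added f² turns the
    -- constant 15 into 16.
    have hB : B = f x - A := by rw [hf]; simp only; linarith
    refine le_trans ?_ (add_le_add_left (hx δ hδ) _)
    rw [hB, ← enorm_pow, ← enorm_pow, ← enorm_pow, Real.enorm_of_nonneg (sq_nonneg _),
      Real.enorm_of_nonneg (sq_nonneg _), Real.enorm_of_nonneg (sq_nonneg _),
      ← ENNReal.ofReal_add (sq_nonneg _) (sq_nonneg _)]
    exact ENNReal.ofReal_le_ofReal (by nlinarith [sq_nonneg (f x + A), sq_nonneg (f x), sq_nonneg A])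

/-- Use scales 2^(-j), 2^(-j-1) and 2^(5j) shells. The equation yields a factor 2^(-j); the
discretisation error carries h⁻⁴ = 16^j against 32^(-j), again 2^(-j); the logarithmic cost is
polynomial in j. Hence (16/9)^j ∫ G_j is summable, so (16/9)^j G_j(x) is bounded in j almost
everywhere, and a square root gives the ratio 3/4. -/
lemma exists_geometric_bound {ν : Measure ℝ} {r₀ : ℝ} (hν : IsSymmDiffuseLevy ν) (hr₀ : 0 < r₀)
    (hsupp : ν.support ⊆ Ioo (-r₀) r₀) {w F : ℝ → ℝ} (hw : Continuous w) {C : ℝ}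
    (hC : ∀ x, |w x| ≤ C) {K : ℝ} (hK0 : 0 ≤ K) (hwK : HasHalfModulus K w) (hF : Continuous F)
    (hFK : HasHalfModulus K F)
    (heq : ∀ h, h ≠ 0 → ∀ x,
      ∫ z, tentAvg z (secondDiff h w) x ∂(sqWeighted ν) = -2 * h ^ 2 * tentAvg h F x) :
    ∀ᵐ x, ∃ M : ℝ, 0 ≤ M ∧ ∀ j : ℕ, ∀ δ : ℝ, 0 < δ →
      |∫ z, ((tentAvg ((1 / 2) ^ j) w (x + z) - tentAvg ((1 / 2) ^ (j + 1)) w (x + z))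
        - (tentAvg ((1 / 2) ^ j) w x - tentAvg ((1 / 2) ^ (j + 1)) w x)) ∂(levyTrunc ν δ)|
        ≤ M * (3 / 4) ^ j := by
  choose G hGm hGle hG using fun j : ℕ => exists_maximal_levyTrunc hν hr₀ hsupp hw hC hK0 hwK hF hFK
    heq (h := (1 / 2) ^ j) (k := (1 / 2) ^ (j + 1)) (by positivity) (by positivity) (5 * j)
  set P := (sqWeighted ν).real univ
  set D : ℝ := 800 * (4 * K) + 12 * (P ^ 2 * (544 * K * r₀)) with hD
  have hP0 : 0 ≤ P := measureReal_nonneg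
  have hD0 : 0 ≤ D := by positivity
  have hGle' : ∀ j, ∫⁻ x, G j x ≤ ENNReal.ofReal (D * ((j + 1) ^ 2 * (1 / 2) ^ j)) := by
    intro j
    refine (hGle j).trans (ENNReal.ofReal_le_ofReal ?_)
    have e1 : |((1 : ℝ) / 2) ^ j - (1 / 2) ^ (j + 1)| = (1 / 2) * (1 / 2) ^ j := by
      rw [pow_succ, abs_of_nonneg (by nlinarith [show (0 : ℝ) < (1 / 2) ^ j by positivity])]
      ring
    have e2 : ∀ j : ℕ, (((1 / 2 : ℝ) ^ j) ^ 2)⁻¹ ^ 2 = 16 ^ j := by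
      intro j
      rw [← pow_mul, inv_pow, ← pow_mul, one_div, inv_pow, inv_inv, mul_assoc, mul_comm, pow_mul]
      norm_num
    have e3 : (16 : ℝ) ^ j * (r₀ / 2 ^ (5 * j)) = r₀ * (1 / 2) ^ j := by
      rw [pow_mul, mul_div_assoc', mul_comm, mul_div_assoc, ← div_pow]; norm_num
    rw [e1, e2, e2]
    push_cast
    have h1 : (5 * (j : ℝ) + 1) ^ 2 ≤ 25 * (j + 1) ^ 2 := by
      nlinarith [(Nat.cast_nonneg j : (0 : ℝ) ≤ j)]
    have h2 : (1 : ℝ) ≤ (j + 1) ^ 2 :=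
      one_le_pow₀ (by linarith [(Nat.cast_nonneg j : (0 : ℝ) ≤ j)])
    have h3 : (32 * 16 ^ j * K + 32 * 16 ^ (j + 1) * K) * (r₀ / 2 ^ (5 * j))
        = 544 * K * r₀ * (1 / 2) ^ j := by
      calc _ = 544 * K * (16 ^ j * (r₀ / 2 ^ (5 * j))) := by ring
        _ = _ := by rw [e3]; ring
    rw [h3]
    set y : ℝ := (1 / 2) ^ j
    have hy : 0 < y := by positivity
    calc 16 * (5 * (j : ℝ) + 1) ^ 2 * (4 * K * (1 / 2 * y)) + 12 * (P ^ 2 * (544 * K * r₀ * y))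
        ≤ 16 * (25 * (j + 1) ^ 2) * (4 * K * (2 * y))
          + 12 * (P ^ 2 * (544 * K * r₀ * y)) * (j + 1) ^ 2 := by
          refine add_le_add ?_ (le_mul_of_one_le_right (by positivity) h2)
          gcongr
          norm_num
      _ = _ := by rw [hD]; ring
  have hsum : Summable (fun j : ℕ => D * (((j : ℝ) + 1) ^ 2 * (8 / 9) ^ j)) := by
    refine Summable.mul_left _ ?_
    have h1 := summable_pow_mul_geometric_of_norm_lt_one (R := ℝ) 2 (r := 8 / 9) (by norm_num)
    have h2 := (summable_nat_add_iff 1).2 h1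
    refine (h2.mul_left (9 / 8)).congr fun j => ?_
    push_cast
    rw [pow_succ]
    ring
  have hfin : ∫⁻ x, ∑' j, ENNReal.ofReal ((16 / 9) ^ j) * G j x < ⊤ := by
    rw [lintegral_tsum fun j => ((hGm j).const_mul _).aemeasurable]
    calc ∑' j, ∫⁻ x, ENNReal.ofReal ((16 / 9) ^ j) * G j x
        ≤ ∑' j : ℕ, ENNReal.ofReal (D * (((j : ℝ) + 1) ^ 2 * (8 / 9) ^ j)) := by
          refine ENNReal.tsum_le_tsum fun j => ?_
          rw [lintegral_const_mul _ (hGm j)]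
          refine (mul_le_mul_right (hGle' j) _).trans ?_
          rw [← ENNReal.ofReal_mul (by positivity)]
          refine le_of_eq (congrArg _ ?_)
          rw [show (8 / 9 : ℝ) = 16 / 9 * (1 / 2) by norm_num, mul_pow]
          ring
      _ = ENNReal.ofReal (∑' j : ℕ, D * (((j : ℝ) + 1) ^ 2 * (8 / 9) ^ j)) :=
          (ENNReal.ofReal_tsum_of_nonneg (fun j => by positivity) hsum).symm
      _ < ⊤ := ENNReal.ofReal_lt_top
  have hae := ae_lt_top (Measurable.tsum fun j => (hGm j).const_mul (ENNReal.ofReal ((16 / 9) ^ j)))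
    hfin.ne
  filter_upwards [hae, ae_all_iff.2 hG] with x hx hGx
  set T := ∑' j, ENNReal.ofReal ((16 / 9) ^ j) * G j x
  refine ⟨Real.sqrt T.toReal, Real.sqrt_nonneg _, fun j δ hδ => ?_⟩
  have h1 := hGx j δ hδ
  set I := ∫ z, ((tentAvg ((1 / 2) ^ j) w (x + z) - tentAvg ((1 / 2) ^ (j + 1)) w (x + z))
        - (tentAvg ((1 / 2) ^ j) w x - tentAvg ((1 / 2) ^ (j + 1)) w x)) ∂(levyTrunc ν δ)
  have h2 : ENNReal.ofReal ((16 / 9) ^ j) * G j x ≤ T :=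
    ENNReal.le_tsum (f := fun j => ENNReal.ofReal ((16 / 9) ^ j) * G j x) j
  rw [← enorm_pow, Real.enorm_of_nonneg (sq_nonneg _)] at h1
  have h3 : ENNReal.ofReal ((16 / 9) ^ j * I ^ 2) ≤ T := by
    rw [ENNReal.ofReal_mul (by positivity)]
    exact (mul_le_mul_right h1 _).trans h2
  have h4 := (ENNReal.ofReal_le_iff_le_toReal hx.ne).1 h3
  refine abs_le_of_sq_le_sq ?_ (by positivity)
  rw [mul_pow, Real.sq_sqrt ENNReal.toReal_nonneg]
  have h5 : ((3 / 4 : ℝ) ^ j) ^ 2 * (16 / 9) ^ j = 1 := by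
    rw [← pow_mul, mul_comm j, pow_mul, ← mul_pow]; norm_num
  calc I ^ 2 = ((16 / 9) ^ j * I ^ 2) * ((3 / 4 : ℝ) ^ j) ^ 2 := by
        rw [mul_right_comm, mul_comm ((16 / 9 : ℝ) ^ j), h5, one_mul]
    _ ≤ _ := by gcongr

/-- A bounded continuous function with an `L²` modulus which solves the averaged equation
`D_ν[tentAvg h w] = -tentAvg h F` at every scale has `D_ν[w] = -F` almost everywhere,
as a principal value. -/
theorem ae_hasNonlocalOp {ν : Measure ℝ} {r₀ : ℝ} (hν : IsSymmDiffuseLevy ν) (hr₀ : 0 < r₀)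
    (hsupp : ν.support ⊆ Ioo (-r₀) r₀) {w F : ℝ → ℝ} (hw : Continuous w) {C : ℝ}
    (hC : ∀ x, |w x| ≤ C) {K : ℝ} (hK0 : 0 ≤ K) (hwK : HasHalfModulus K w) (hF : Continuous F)
    {C' : ℝ} (hFC : ∀ x, |F x| ≤ C') (hFK : HasHalfModulus K F)
    (heq : ∀ h, h ≠ 0 → ∀ x,
      ∫ z, tentAvg z (secondDiff h w) x ∂(sqWeighted ν) = -2 * h ^ 2 * tentAvg h F x) :
    ∀ᵐ x, HasNonlocalOp ν w x (-F x) := by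
  have hfin : IsFiniteMeasure (sqWeighted ν) := isFiniteMeasure_sqWeighted hν hsupp
  have hπ0 : sqWeighted ν {0} = 0 := sqWeighted_absolutelyContinuous ν hν.zero
  have hpow : Tendsto (fun j : ℕ => ((1 : ℝ) / 2) ^ j) atTop (𝓝 0) :=
    tendsto_pow_atTop_nhds_zero_of_lt_one (by norm_num) (by norm_num)
  have happ : ∀ {u : ℝ → ℝ} (_ : Continuous u) {B : ℝ} (_ : ∀ x, |u x| ≤ B) (x : ℝ),
      Tendsto (fun j : ℕ => tentAvg ((1 / 2) ^ j) u x) atTop (𝓝 (u x)) := by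
    intro u hu B hB x
    have := ((continuous_tentAvg_left hu hB x).tendsto 0).comp hpow
    rwa [tentAvg_zero] at this
  filter_upwards [exists_geometric_bound hν hr₀ hsupp hw hC hK0 hwK hF hFK heq] with x hx
  obtain ⟨M, hM0, hM⟩ := hx
  have hint : ∀ δ : ℝ, 0 < δ → ∀ {u : ℝ → ℝ}, Continuous u → ∀ {B : ℝ}, (∀ x, |u x| ≤ B) →
      Integrable (fun z => u (x + z) - u x) (levyTrunc ν δ) := by
    intro δ hδ u hu B hB
    have := isFiniteMeasure_levyTrunc hν hδ
    exact (integrable_translate hu.measurable hB _ x).sub (integrable_const _)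
  refine ⟨fun δ hδ => hint δ hδ hw hC, ?_⟩
  set T : ℝ → (ℝ → ℝ) → ℝ := fun δ u => ∫ z, (u (x + z) - u x) ∂(levyTrunc ν δ) with hT
  set W : ℕ → ℝ → ℝ := fun j => tentAvg ((1 / 2) ^ j) w with hW
  have hWc : ∀ j, Continuous (W j) := fun j => continuous_tentAvg hw hC _
  have hWC : ∀ j x, |W j x| ≤ C := fun j x => abs_tentAvg_le hC _ x
  have hTlim : ∀ δ, 0 < δ → Tendsto (fun j => T δ (W j)) atTop (𝓝 (T δ w)) := by
    intro δ hδ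
    have := isFiniteMeasure_levyTrunc hν hδ
    refine tendsto_integral_of_dominated_convergence (fun _ => C + C) ?_ (integrable_const _) ?_ ?_
    · intro j
      exact (hint δ hδ (hWc j) (hWC j)).aestronglyMeasurable
    · intro j
      exact ae_of_all _ fun z => (abs_sub _ _).trans (add_le_add (hWC j _) (hWC j _))
    · exact ae_of_all _ fun z => (happ hw hC _).sub (happ hw hC _)
  -- Telescoping the geometric bounds makes the convergence in j uniform in δ, which justifies
  -- exchanging j → ∞ with δ → 0.
  have hdist : ∀ δ, 0 < δ → ∀ j, dist (T δ (W j)) (T δ w) ≤ M * (3 / 4) ^ j / (1 - 3 / 4) := by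
    intro δ hδ j
    refine dist_le_of_le_geometric_of_tendsto (3 / 4) M (by norm_num) (fun i => ?_) (hTlim δ hδ) j
    rw [Real.dist_eq]
    refine le_trans (le_of_eq ?_) (hM i δ hδ)
    simp only [hT]
    rw [← integral_sub (hint δ hδ (hWc i) (hWC i)) (hint δ hδ (hWc (i + 1)) (hWC (i + 1)))]
    congr 2; ext z; simp only [hW]; ring
  have hTW : ∀ j, Tendsto (fun δ => T δ (W j)) (𝓝[>] 0) (𝓝 (-tentAvg ((1 / 2) ^ j) F x)) := by
    intro j
    set h : ℝ := (1 / 2) ^ j with hh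
    have hne : h ≠ 0 := by positivity
    have hi : Integrable (fun z => tentAvg z (secondDiff h w) x / h ^ 2) (sqWeighted ν) :=
      (integrable_tentAvg_left (continuous_secondDiff hw h) (abs_secondDiff_le hC h) x _).div_const _
    have h1 := (tendsto_setIntegral_compl_Icc hπ0 hi).const_mul 2⁻¹
    have h2 : 2⁻¹ * ∫ z, tentAvg z (secondDiff h w) x / h ^ 2 ∂(sqWeighted ν)
        = -tentAvg h F x := by
      rw [integral_div, heq h hne]; field_simp
    rw [h2] at h1
    refine h1.congr' ?_
    filter_upwards [self_mem_nhdsWithin] with δ hδ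
    exact (integral_diff_levyTrunc_eq_sqWeighted hν (hWc j).measurable (hWC j)
      (fun z => secondDiff_tentAvg hw z x hne) hδ).symm
  rw [Metric.tendsto_nhds]
  intro e he
  have hg : Tendsto (fun j : ℕ => M * (3 / 4 : ℝ) ^ j / (1 - 3 / 4)) atTop (𝓝 0) := by
    have := ((tendsto_pow_atTop_nhds_zero_of_lt_one (r := (3 / 4 : ℝ)) (by norm_num)
      (by norm_num)).const_mul M).div_const (1 - 3 / 4)
    simpa using this
  obtain ⟨j, hj1, hj2⟩ := ((hg.eventually (gt_mem_nhds (show 0 < e / 3 by positivity))).and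
    (Metric.tendsto_nhds.1 (happ hF hFC x) (e / 3) (by positivity))).exists
  filter_upwards [Metric.tendsto_nhds.1 (hTW j) (e / 3) (by positivity), self_mem_nhdsWithin]
    with δ h1 h2
  have h3 := hdist δ h2 j
  have t1 := dist_triangle (T δ w) (T δ (W j)) (-F x)
  have t2 := dist_triangle (T δ (W j)) (-tentAvg ((1 / 2) ^ j) F x) (-F x)
  rw [dist_comm] at h3
  have t3 : dist (-tentAvg ((1 / 2) ^ j) F x) (-F x) < e / 3 := by rwa [dist_neg_neg]
  linarith

/-! ### Bounded monotone functions: moduli and compactness. -/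

section Antitone

variable {u : ℝ → ℝ} {γ : ℝ}

/-- Over [-n, n] the integral telescopes to two windows of length h at the ends. The left one is at
most γh and the right one enters with a minus sign. -/
lemma lintegral_sub_comp_add_le (hu : Antitone u) (h0 : ∀ x, 0 ≤ u x) (hγ : ∀ x, u x ≤ γ) {h : ℝ}
    (hh : 0 ≤ h) : ∫⁻ x, ENNReal.ofReal (u x - u (x + h)) ≤ ENNReal.ofReal (γ * h) := by
  have hint : ∀ a b, IntervalIntegrable u volume a b := fun a b => hu.intervalIntegrable
  have hm : Measurable u := hu.measurable
  have hcov : AECover volume atTop (fun n : ℕ => Ioc (-(n : ℝ)) n) :=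
    aecover_Ioc (tendsto_neg_atTop_atBot.comp tendsto_natCast_atTop_atTop)
      tendsto_natCast_atTop_atTop
  refine le_of_tendsto' (hcov.lintegral_tendsto_of_countably_generated
    (f := fun x => ENNReal.ofReal (u x - u (x + h))) (by fun_prop)) fun n => ?_
  have hn : (-(n : ℝ)) ≤ n := by linarith [(Nat.cast_nonneg n : (0 : ℝ) ≤ n)]
  have hint' : IntervalIntegrable (fun x => u (x + h)) volume (-n) n :=
    (hu.comp_monotone fun x y hxy => add_le_add_left hxy h :
      Antitone fun x => u (x + h)).intervalIntegrable
  rw [← ofReal_integral_eq_lintegral_ofReal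
    ((intervalIntegrable_iff_integrableOn_Ioc_of_le hn).1 ((hint _ _).sub hint'))
    (ae_of_all _ fun x => sub_nonneg.2 (hu (by linarith))),
    ← intervalIntegral.integral_of_le hn]
  refine ENNReal.ofReal_le_ofReal ?_
  rw [intervalIntegral.integral_sub (hint _ _) hint', intervalIntegral.integral_comp_add_right]
  have e1 : ∫ x in (-n : ℝ)..n, u x = (∫ x in (-n : ℝ)..(-n + h), u x) + ∫ x in (-n + h)..n, u x :=
    (intervalIntegral.integral_add_adjacent_intervals (hint _ _) (hint _ _)).symm
  have e2 : ∫ x in (-n + h : ℝ)..(n + h), u x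
      = (∫ x in (-n + h : ℝ)..n, u x) + ∫ x in (n : ℝ)..(n + h), u x :=
    (intervalIntegral.integral_add_adjacent_intervals (hint _ _) (hint _ _)).symm
  rw [e1, e2]
  have h1 : ∫ x in (-n : ℝ)..(-n + h), u x ≤ ∫ x in (-n : ℝ)..(-n + h), γ :=
    intervalIntegral.integral_mono_on (by linarith) (hint _ _) (by simp) fun x _ => hγ x
  have h2 : 0 ≤ ∫ x in (n : ℝ)..(n + h), u x :=
    intervalIntegral.integral_nonneg (by linarith) fun x _ => h0 x
  rw [intervalIntegral.integral_const, smul_eq_mul] at h1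
  linarith

lemma lintegral_enorm_translate_sub_le (hu : Antitone u) (h0 : ∀ x, 0 ≤ u x) (hγ : ∀ x, u x ≤ γ)
    (a b : ℝ) : ∫⁻ x, ‖u (x + a) - u (x + b)‖ₑ ≤ ENNReal.ofReal (γ * |a - b|) := by
  wlog hab : a ≤ b generalizing a b
  · have := this b a (le_of_not_ge hab)
    rw [abs_sub_comm]
    refine le_trans (le_of_eq (lintegral_congr fun x => ?_)) this
    rw [← neg_sub, enorm_neg]
  have h1 := lintegral_sub_comp_add_le (u := fun x => u (x + a))
    (fun x y hxy => hu (add_le_add_left hxy a)) (fun x => h0 _) (fun x => hγ _)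
    (sub_nonneg.2 hab)
  rw [abs_sub_comm, abs_of_nonneg (sub_nonneg.2 hab)]
  refine le_trans (le_of_eq (lintegral_congr fun x => ?_)) h1
  rw [show x + (b - a) + a = x + b by ring, Real.enorm_of_nonneg (sub_nonneg.2 (hu (by linarith)))]

/-- Interpolation: one factor of the squared increment is bounded by γ, the other is integrated with
the L¹ modulus of a monotone function. -/
lemma hasHalfModulus_of_abs_sub_le (hu : Antitone u) (h0 : ∀ x, 0 ≤ u x) (hγ : ∀ x, u x ≤ γ)
    {F : ℝ → ℝ} {L : ℝ} (hF : ∀ x y, |F x - F y| ≤ L * |u x - u y|) :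
    HasHalfModulus (L ^ 2 * γ ^ 2) F := by
  have hγ0 : 0 ≤ γ := (h0 0).trans (hγ 0)
  intro a b
  calc ∫⁻ x, ‖F (x + a) - F (x + b)‖ₑ ^ 2
      ≤ ∫⁻ x, ENNReal.ofReal (L ^ 2 * γ) * ‖u (x + a) - u (x + b)‖ₑ := by
        refine lintegral_mono fun x => ?_
        rw [← enorm_pow, Real.enorm_of_nonneg (sq_nonneg _), Real.enorm_eq_ofReal_abs,
          ← ENNReal.ofReal_mul (by positivity)]
        refine ENNReal.ofReal_le_ofReal ?_
        have h1 := hF (x + a) (x + b)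
        have h2 : |u (x + a) - u (x + b)| ≤ γ := by
          rw [abs_le]
          constructor <;> linarith [h0 (x + a), h0 (x + b), hγ (x + a), hγ (x + b)]
        rw [← sq_abs]
        calc |F (x + a) - F (x + b)| ^ 2 ≤ (L * |u (x + a) - u (x + b)|) ^ 2 := by gcongr
          _ = L ^ 2 * |u (x + a) - u (x + b)| * |u (x + a) - u (x + b)| := by ring
          _ ≤ L ^ 2 * γ * |u (x + a) - u (x + b)| := by gcongr
    _ = ENNReal.ofReal (L ^ 2 * γ) * ∫⁻ x, ‖u (x + a) - u (x + b)‖ₑ :=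
        lintegral_const_mul' _ _ ENNReal.ofReal_ne_top
    _ ≤ ENNReal.ofReal (L ^ 2 * γ) * ENNReal.ofReal (γ * |a - b|) := by
        gcongr; exact lintegral_enorm_translate_sub_le hu h0 hγ a b
    _ = _ := by
        rw [← ENNReal.ofReal_mul (by positivity)]; congr 1; ring

end Antitone

/-- Helly's selection theorem for uniformly bounded nonincreasing functions. -/
lemma exists_subseq_tendsto_of_antitone {u : ℕ → ℝ → ℝ} {γ : ℝ} (hu : ∀ n, Antitone (u n))
    (h0 : ∀ n x, 0 ≤ u n x) (hγ : ∀ n x, u n x ≤ γ) :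
    ∃ (φ : ℕ → ℕ) (w : ℝ → ℝ), StrictMono φ ∧ Antitone w ∧ (∀ x, 0 ≤ w x) ∧ (∀ x, w x ≤ γ) ∧
      ∀ x, ContinuousAt w x → Tendsto (fun n => u (φ n) x) atTop (𝓝 (w x)) := by
  have hc : IsCompact (Set.pi univ fun _ : ℚ => Icc (0 : ℝ) γ) :=
    isCompact_univ_pi fun _ => isCompact_Icc
  obtain ⟨W, hW, φ, hφ, hlim⟩ := hc.tendsto_subseq (x := fun n (q : ℚ) => u n q)
    (fun n q _ => ⟨h0 n q, hγ n q⟩)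
  have hq : ∀ q : ℚ, Tendsto (fun n => u (φ n) q) atTop (𝓝 (W q)) := fun q =>
    (tendsto_pi_nhds.1 hlim) q
  have hW' : ∀ q, W q ∈ Icc (0 : ℝ) γ := fun q => hW q (mem_univ q)
  -- Convergence holds on the rationals; `w` is the left limit of the limit there. At a continuity
  -- point of `w`, rationals on either side squeeze the sequence.
  set w : ℝ → ℝ := fun x => ⨅ q : {q : ℚ // (q : ℝ) < x}, W q with hw
  have hne : ∀ x : ℝ, Nonempty {q : ℚ // (q : ℝ) < x} := fun x =>
    (exists_rat_lt x).elim fun q hq => ⟨⟨q, hq⟩⟩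
  have hbdd : ∀ x : ℝ, BddBelow (range fun q : {q : ℚ // (q : ℝ) < x} => W q) := fun x =>
    ⟨0, by rintro _ ⟨q, rfl⟩; exact (hW' q).1⟩
  have hwle : ∀ (x : ℝ) (q : ℚ), (q : ℝ) < x → w x ≤ W q := fun x q hqx =>
    ciInf_le (hbdd x) ⟨q, hqx⟩
  have hanti : Antitone w := by
    intro x y hxy
    have := hne x
    exact le_ciInf fun q => hwle y q (q.2.trans_le hxy)
  have hWanti : ∀ q q' : ℚ, q ≤ q' → W q' ≤ W q := fun q q' h =>
    le_of_tendsto_of_tendsto' (hq q') (hq q) fun n => hu _ (by exact_mod_cast h)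
  have hlew : ∀ (x : ℝ) (q : ℚ), x ≤ q → W q ≤ w x := by
    intro x q hxq
    have := hne x
    exact le_ciInf fun q' => hWanti _ _ (by exact_mod_cast (q'.2.trans_le hxq).le)
  refine ⟨φ, w, hφ, hanti, fun x => ?_, fun x => ?_, fun x hx => ?_⟩
  · have := hne x
    exact le_ciInf fun q => (hW' q).1
  · obtain ⟨q, hqx⟩ := exists_rat_lt x
    exact (hwle x q hqx).trans (hW' q).2
  · rw [tendsto_order]
    constructor
    · intro a ha
      obtain ⟨l, r, hxI, hI⟩ := mem_nhds_iff_exists_Ioo_subset.1 (hx.eventually (lt_mem_nhds ha))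
      obtain ⟨q, hq1, hq2⟩ := exists_rat_btwn hxI.2
      obtain ⟨y, hy1, hy2⟩ := exists_between hq2
      have h1 : a < W q := lt_of_lt_of_le (hI ⟨(hxI.1.trans hq1).trans hy1, hy2⟩ : a < w y)
        (hwle y q hy1)
      filter_upwards [(hq q).eventually (lt_mem_nhds h1)] with n hn
      exact hn.trans_le (hu _ hq1.le)
    · intro a ha
      obtain ⟨l, r, hxI, hI⟩ := mem_nhds_iff_exists_Ioo_subset.1 (hx.eventually (gt_mem_nhds ha))
      obtain ⟨q, hq1, hq2⟩ := exists_rat_btwn hxI.1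
      have h1 : W q < a := lt_of_le_of_lt (hlew q q le_rfl) (hI ⟨hq1, hq2.trans hxI.2⟩ : w q < a)
      filter_upwards [(hq q).eventually (gt_mem_nhds h1)] with n hn
      exact (hu _ hq2.le).trans_lt hn

/-! ### Fronts of truncated measures. -/

lemma continuous_integral_translate_sub {u : ℝ → ℝ} (hu : Continuous u) {C : ℝ}
    (hC : ∀ x, |u x| ≤ C) (μ : Measure ℝ) [IsFiniteMeasure μ] :
    Continuous (fun x => ∫ z, (u (x + z) - u x) ∂μ) := by
  refine continuous_of_dominated (bound := fun _ => C + C) (fun x => ?_) (fun x => ?_)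
    (integrable_const _) ?_
  · exact Continuous.aestronglyMeasurable (by fun_prop)
  · exact ae_of_all _ fun z => (abs_sub _ _).trans (add_le_add (hC _) (hC _))
  · exact ae_of_all _ fun z => by fun_prop

lemma levyTrunc_levyTrunc (ν : Measure ℝ) {ε δ : ℝ} (h : δ ≤ ε) :
    levyTrunc (levyTrunc ν ε) δ = levyTrunc ν ε := by
  rw [levyTrunc, levyTrunc, Measure.restrict_restrict measurableSet_Icc.compl,
    inter_eq_self_of_subset_right]
  exact compl_subset_compl.2 (Icc_subset_Icc (neg_le_neg h) h)

/-- For a truncated measure the nonlocal operator is an absolutely convergent integral. -/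
lemma HasNonlocalOp.eq_integral {ν : Measure ℝ} {ε : ℝ} (hε : 0 < ε) {u : ℝ → ℝ} {x L : ℝ}
    (h : HasNonlocalOp (levyTrunc ν ε) u x L) :
    L = ∫ z, (u (x + z) - u x) ∂(levyTrunc ν ε) := by
  refine tendsto_nhds_unique h.2 (tendsto_const_nhds.congr' ?_)
  filter_upwards [Ioc_mem_nhdsGT hε] with δ hδ
  rw [levyTrunc_levyTrunc ν hδ.2]

lemma IsFront.nonneg {ν : Measure ℝ} {g : ℝ → ℝ} {γ c : ℝ} {u : ℝ → ℝ} (h : IsFront ν g γ c u)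
    (x : ℝ) : 0 ≤ u x := h.antitone.le_of_tendsto h.tendsto_atTop x

lemma IsFront.le {ν : Measure ℝ} {g : ℝ → ℝ} {γ c : ℝ} {u : ℝ → ℝ} (h : IsFront ν g γ c u)
    (x : ℝ) : u x ≤ γ := h.antitone.ge_of_tendsto h.tendsto_atBot x

/-- For a finite measure both sides are continuous in x, so equality almost everywhere is equality
everywhere. -/
lemma IsFront.equation {ν : Measure ℝ} (hν : IsSymmDiffuseLevy ν) {g : ℝ → ℝ} (hg : Continuous g)
    {γ c ε : ℝ} (hε : 0 < ε) {u : ℝ → ℝ} (hu : ContDiff ℝ 2 u)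
    (h : IsFront (levyTrunc ν ε) g γ c u) (x : ℝ) :
    -c * deriv u x = ∫ z, (u (x + z) - u x) ∂(levyTrunc ν ε) + g (u x) := by
  have := isFiniteMeasure_levyTrunc hν hε
  have hd : Continuous (deriv u) := hu.continuous_deriv (by norm_num)
  have hb : ∀ x, |u x| ≤ γ := fun x => abs_le.2 ⟨by linarith [h.nonneg x, h.le x], h.le x⟩
  have hcont := continuous_integral_translate_sub hu.continuous hb (levyTrunc ν ε)
  have hae : (fun x => -c * deriv u x)
      =ᵐ[volume] fun x => ∫ z, (u (x + z) - u x) ∂(levyTrunc ν ε) + g (u x) := by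
    filter_upwards [h.eqn] with x hx
    obtain ⟨L, hL, he⟩ := hx
    rw [he, hL.eq_integral hε]
  exact congrFun ((Continuous.ae_eq_iff_eq volume (by fun_prop)
    (hcont.add (hg.comp hu.continuous))).1 hae) x

/-- A translate of a front is a front; the equation is recorded at every point. -/
structure IsTruncFront (ν : Measure ℝ) (g : ℝ → ℝ) (γ c ε : ℝ) (u : ℝ → ℝ) : Prop where
  antitone : Antitone u
  nonneg : ∀ x, 0 ≤ u x
  le : ∀ x, u x ≤ γ
  contDiff : ContDiff ℝ 2 u
  equation : ∀ x, -c * deriv u x = ∫ z, (u (x + z) - u x) ∂(levyTrunc ν ε) + g (u x)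
  tendsto_atBot : Tendsto u atBot (𝓝 γ)
  tendsto_atTop : Tendsto u atTop (𝓝 0)

/-- Prescribing the value at 0 removes the translation freedom, which could otherwise make the limit
constant. -/
lemma IsFront.exists_isTruncFront {ν : Measure ℝ} (hν : IsSymmDiffuseLevy ν) {g : ℝ → ℝ}
    (hg : Continuous g) {γ c ε : ℝ} (hε : 0 < ε) {u : ℝ → ℝ} (hu : ContDiff ℝ 2 u)
    (h : IsFront (levyTrunc ν ε) g γ c u) {s : ℝ} (hs : s ∈ Ioo 0 γ) :
    ∃ v : ℝ → ℝ, IsTruncFront ν g γ c ε v ∧ v 0 = s := by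
  obtain ⟨y, hy⟩ : ∃ y, u y = s := by
    have h1 := (h.tendsto_atTop.eventually (gt_mem_nhds hs.1)).exists
    have h2 := (h.tendsto_atBot.eventually (lt_mem_nhds hs.2)).exists
    obtain ⟨a, ha⟩ := h1
    obtain ⟨b, hb⟩ := h2
    exact mem_range_of_exists_le_of_exists_ge hu.continuous ⟨a, ha.le⟩ ⟨b, hb.le⟩
  refine ⟨fun x => u (x + y), ⟨fun a b hab => h.antitone (add_le_add_left hab y),
    fun x => h.nonneg _, fun x => h.le _, hu.comp (by fun_prop), fun x => ?_,
    h.tendsto_atBot.comp (tendsto_atBot_add_const_right _ y tendsto_id),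
    h.tendsto_atTop.comp (tendsto_atTop_add_const_right _ y tendsto_id)⟩, by simpa using hy⟩
  have := h.equation hν hg hε hu (x + y)
  rw [deriv_comp_add_const, this]
  congr 2
  ext z
  rw [show x + z + y = x + y + z by ring]

/-! ### Energy estimate and continuity of the limit. -/

/-- The energy of the increments of a front is controlled by the size of the increment. -/
lemma IsTruncFront.energy_le {ν : Measure ℝ} (hν : IsSymmDiffuseLevy ν) {g : ℝ → ℝ}
    (hg : Continuous g) {γ c ε L : ℝ} (hε : 0 < ε) {u : ℝ → ℝ}
    (hu : IsTruncFront ν g γ c ε u) (hL0 : 0 ≤ L)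
    (hL : ∀ s ∈ Icc 0 γ, ∀ t ∈ Icc 0 γ, |g s - g t| ≤ L * |s - t|) {h : ℝ} (hh : 0 < h) :
    ∫⁻ z, ∫⁻ x, ‖(u (x + z + h) - u (x + z)) - (u (x + h) - u x)‖ₑ ^ 2 ∂volume ∂(levyTrunc ν ε)
      ≤ ENNReal.ofReal (2 * L * γ ^ 2 * h) := by
  have hfin := isFiniteMeasure_levyTrunc hν hε
  set μ := levyTrunc ν ε
  have hγ0 : 0 ≤ γ := (hu.nonneg 0).trans (hu.le 0)
  have huc := hu.contDiff.continuous
  set v : ℝ → ℝ := fun x => u (x + h) - u x with hv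
  have hvc : Continuous v := by fun_prop
  have hvb : ∀ x, |v x| ≤ γ := fun x => by
    rw [abs_le]; constructor <;> simp only [hv] <;>
      linarith [hu.nonneg (x + h), hu.nonneg x, hu.le (x + h), hu.le x]
  have hv1 : ∫⁻ x, ‖v x‖ₑ ≤ ENNReal.ofReal (γ * h) := by
    have := lintegral_enorm_translate_sub_le hu.antitone hu.nonneg hu.le h 0
    simpa [hv, abs_of_pos hh] using this
  have hvi : Integrable v := ⟨hvc.aestronglyMeasurable, hv1.trans_lt ENNReal.ofReal_lt_top⟩
  have hvv : Integrable (fun x => v x ^ 2) := by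
    simpa [sq] using hvi.mul_bdd hvc.aestronglyMeasurable (ae_of_all _ hvb)
  set k : ℝ → ℝ → ℝ := fun z x => (v (x + z) - v x) * v x with hk
  have hkc : Continuous (fun p : ℝ × ℝ => k p.1 p.2) := by fun_prop
  have hki : Integrable (fun p : ℝ × ℝ => k p.1 p.2) (μ.prod volume) := by
    refine ⟨hkc.aestronglyMeasurable, ?_⟩
    rw [HasFiniteIntegral, lintegral_prod _ hkc.aestronglyMeasurable.enorm]
    calc ∫⁻ z, (∫⁻ x, ‖k z x‖ₑ) ∂μ ≤ ∫⁻ _, (ENNReal.ofReal (2 * γ) * ∫⁻ x, ‖v x‖ₑ) ∂μ := by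
          refine lintegral_mono fun z => ?_
          rw [← lintegral_const_mul' _ _ ENNReal.ofReal_ne_top]
          refine lintegral_mono fun x => ?_
          simp only [hk, enorm_mul]
          gcongr
          rw [Real.enorm_eq_ofReal_abs]
          refine ENNReal.ofReal_le_ofReal ?_
          have := abs_sub (v (x + z)) (v x)
          linarith [hvb (x + z), hvb x]
      _ < ⊤ := by
          rw [lintegral_const]
          exact ENNReal.mul_lt_top (ENNReal.mul_lt_top ENNReal.ofReal_lt_top
            (hv1.trans_lt ENNReal.ofReal_lt_top)) (measure_lt_top _ _)
  have hkz : ∀ z, Integrable (k z) := by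
    intro z
    refine hvi.bdd_mul (c := 2 * γ) (Continuous.aestronglyMeasurable (by fun_prop))
      (ae_of_all _ fun x => ?_)
    have := abs_sub (v (x + z)) (v x)
    rw [Real.norm_eq_abs]
    linarith [hvb (x + z), hvb x]
  -- Expand the square; by translation invariance v(x+z)² and v(x)² have the same integral.
  have hsq : ∀ z, Integrable (fun x => (v (x + z) - v x) ^ 2) ∧
      ∫ x, (v (x + z) - v x) ^ 2 = -2 * ∫ x, k z x := by
    intro z
    have h1 : Integrable (fun x => v (x + z) ^ 2) := hvv.comp_add_right z
    have e : ∀ x, (v (x + z) - v x) ^ 2 = (v (x + z) ^ 2 - v x ^ 2) + -2 * k z x := by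
      intro x; simp only [hk]; ring
    simp_rw [e]
    refine ⟨(h1.sub hvv).add ((hkz z).const_mul _), ?_⟩
    rw [integral_add (f := fun x => _ - _) (h1.sub hvv) ((hkz z).const_mul _), integral_sub h1 hvv,
      integral_add_right_eq_self (fun x => v x ^ 2), integral_const_mul]
    ring
  have hE : ∫⁻ z, ∫⁻ x, ‖v (x + z) - v x‖ₑ ^ 2 ∂volume ∂μ
      = ENNReal.ofReal (-2 * ∫ z, ∫ x, k z x ∂volume ∂μ) := by
    rw [← integral_const_mul, ofReal_integral_eq_lintegral_ofReal
      (hki.integral_prod_left.const_mul _)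
      (ae_of_all _ fun z => by
        change (0 : ℝ) ≤ -2 * ∫ x, k z x
        rw [← (hsq z).2]; exact integral_nonneg fun x => sq_nonneg _)]
    refine lintegral_congr fun z => ?_
    rw [← (hsq z).2, ofReal_integral_eq_lintegral_ofReal (hsq z).1
      (ae_of_all _ fun x => sq_nonneg _)]
    refine lintegral_congr fun x => ?_
    rw [← enorm_pow, Real.enorm_of_nonneg (sq_nonneg _)]
  have e0 : ∀ z x, (u (x + z + h) - u (x + z)) - (u (x + h) - u x) = v (x + z) - v x :=
    fun z x => rfl
  simp_rw [e0]
  rw [hE]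
  refine ENNReal.ofReal_le_ofReal ?_
  rw [integral_integral_swap hki]
  set gh : ℝ → ℝ := fun x => g (u (x + h)) - g (u x) with hgh
  have hdu : ∀ x, HasDerivAt u (deriv u x) x := fun x =>
    ((hu.contDiff.differentiable (by norm_num)) x).hasDerivAt
  have hdv : ∀ x, HasDerivAt v (deriv u (x + h) - deriv u x) x := fun x =>
    ((hdu (x + h)).comp_add_const x h).sub (hdu x)
  -- Subtract the equations at x + h and x, then multiply by v.
  have hDv : ∀ x, ∫ z, k z x ∂μ
      = -(c * (v x * (deriv u (x + h) - deriv u x))) - v x * gh x := by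
    intro x
    have i1 : ∀ y, Integrable (fun z => u (y + z) - u y) μ := fun y =>
      (integrable_translate huc.measurable
        (fun x => abs_le.2 ⟨by linarith [hu.nonneg x, hu.le x], hu.le x⟩) μ y).sub
        (integrable_const _)
    have : ∀ z, k z x = v x * ((u (x + h + z) - u (x + h)) - (u (x + z) - u x)) := by
      intro z; simp only [hk, hv]; rw [show x + z + h = x + h + z by ring]; ring
    simp_rw [this]
    rw [integral_const_mul, integral_sub (i1 _) (i1 _)]
    have h1 := hu.equation (x + h)
    have h2 := hu.equation x
    have h3 : ∫ z, (u (x + h + z) - u (x + h)) ∂μ - ∫ z, (u (x + z) - u x) ∂μ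
        = -c * (deriv u (x + h) - deriv u x) - gh x := by
      simp only [hgh]; linarith
    rw [h3]; ring
  have hghb : ∀ x, |gh x| ≤ L * |v x| := fun x =>
    hL _ ⟨hu.nonneg _, hu.le _⟩ _ ⟨hu.nonneg _, hu.le _⟩
  have hvg : Integrable (fun x => v x * gh x) := by
    refine hvi.mul_bdd (c := L * γ) (Continuous.aestronglyMeasurable (by fun_prop))
      (ae_of_all _ fun x => ?_)
    exact (hghb x).trans (by gcongr; exact hvb x)
  have hDi : Integrable (fun x => ∫ z, k z x ∂μ) := hki.integral_prod_right
  have hvv'i : Integrable (fun x => c * (v x * (deriv u (x + h) - deriv u x))) := by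
    refine ((hDi.add hvg).neg).congr (ae_of_all _ fun x => ?_)
    simp only [Pi.neg_apply, Pi.add_apply, hDv]
    ring
  have hvlim : ∀ l : Filter ℝ, ∀ a : ℝ, Tendsto u l (𝓝 a) → Tendsto (fun x => u (x + h)) l (𝓝 a) →
      Tendsto (fun x => c / 2 * v x ^ 2) l (𝓝 0) := by
    intro l a h1 h2
    have := ((h2.sub h1).pow 2).const_mul (c / 2)
    simpa using this
  -- The drift term is the derivative of (c/2) v², which vanishes at both ends. Hence the bound does
  -- not depend on c.
  have hzero : ∫ x, c * (v x * (deriv u (x + h) - deriv u x)) = 0 := by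
    have := integral_of_hasDerivAt_of_tendsto (f := fun x => c / 2 * v x ^ 2)
      (f' := fun x => c * (v x * (deriv u (x + h) - deriv u x))) (m := 0) (n := 0)
      (fun x => by
        refine (((hdv x).pow 2).const_mul (c / 2)).congr_deriv ?_
        simp only [Nat.cast_ofNat]
        ring) hvv'i
      (hvlim _ _ hu.tendsto_atBot
        (hu.tendsto_atBot.comp (tendsto_atBot_add_const_right _ h tendsto_id)))
      (hvlim _ _ hu.tendsto_atTop
        (hu.tendsto_atTop.comp (tendsto_atTop_add_const_right _ h tendsto_id)))
    simpa using this
  simp_rw [hDv]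
  rw [integral_sub (f := fun x => -_) hvv'i.neg hvg, integral_neg, hzero]
  have hvgle : ∫ x, v x * gh x ≤ ∫ x, L * γ * |v x| := by
    refine integral_mono hvg (hvi.abs.const_mul _) fun x => ?_
    calc v x * gh x ≤ |v x| * |gh x| := by rw [← abs_mul]; exact le_abs_self _
      _ ≤ γ * (L * |v x|) := by gcongr; exacts [hvb x, hghb x]
      _ = _ := by ring
  have hvabs : ∫ x, |v x| ≤ γ * h := by
    have h1 : ENNReal.ofReal (∫ x, |v x|) = ∫⁻ x, ‖v x‖ₑ := by
      rw [ofReal_integral_eq_lintegral_ofReal hvi.abs (ae_of_all _ fun x => abs_nonneg _)]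
      exact lintegral_congr fun x => (Real.enorm_eq_ofReal_abs _).symm
    exact (ENNReal.ofReal_le_ofReal_iff (by positivity)).1 (h1.le.trans hv1)
  rw [integral_const_mul] at hvgle
  have := mul_le_mul_of_nonneg_left hvabs (show 0 ≤ L * γ by positivity)
  nlinarith

/-- The energy estimate passes to pointwise limits of fronts. -/
lemma energy_le_of_tendsto {ν : Measure ℝ} (hν : IsSymmDiffuseLevy ν) {g : ℝ → ℝ}
    (hg : Continuous g) {γ L : ℝ} {c ε : ℕ → ℝ} (hε : ∀ n, 0 < ε n)
    (hε0 : Tendsto ε atTop (𝓝 0)) {u : ℕ → ℝ → ℝ}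
    (hu : ∀ n, IsTruncFront ν g γ (c n) (ε n) (u n)) (hL0 : 0 ≤ L)
    (hL : ∀ s ∈ Icc 0 γ, ∀ t ∈ Icc 0 γ, |g s - g t| ≤ L * |s - t|) {w : ℝ → ℝ} (hw : Antitone w)
    (hlim : ∀ x, ContinuousAt w x → Tendsto (fun n => u n x) atTop (𝓝 (w x))) {h : ℝ} (hh : 0 < h) :
    ∫⁻ z, ∫⁻ x, ‖(w (x + z + h) - w (x + z)) - (w (x + h) - w x)‖ₑ ^ 2 ∂volume ∂ν
      ≤ ENNReal.ofReal (2 * L * γ ^ 2 * h) := by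
  have hcae : ∀ a : ℝ, ∀ᵐ x : ℝ, ContinuousAt w (x + a) := by
    intro a
    have h1 : ∀ᵐ x : ℝ, ContinuousAt w x := by
      have := hw.countable_not_continuousAt.ae_notMem volume
      filter_upwards [this] with x hx
      simpa using hx
    exact (measurePreserving_add_right volume a).quasiMeasurePreserving.ae h1
  set I : ℕ → ℝ → ENNReal := fun n z =>
    ∫⁻ x, ‖(u n (x + z + h) - u n (x + z)) - (u n (x + h) - u n x)‖ₑ ^ 2 with hI
  have huc : ∀ n, Continuous (u n) := fun n => (hu n).contDiff.continuous
  have hIm : ∀ n, Measurable (I n) := by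
    intro n
    have hcont := huc n
    refine Measurable.lintegral_prod_right' (f := fun p : ℝ × ℝ =>
      ‖(u n (p.2 + p.1 + h) - u n (p.2 + p.1)) - (u n (p.2 + h) - u n p.2)‖ₑ ^ 2) ?_
    exact (Continuous.measurable (by fun_prop)).enorm.pow_const 2
  -- Fatou in x here and in z below. Pointwise convergence fails at most on countably many
  -- translates, the discontinuities of a monotone function.
  have h1 : ∀ z, ∫⁻ x, ‖(w (x + z + h) - w (x + z)) - (w (x + h) - w x)‖ₑ ^ 2
      ≤ liminf (fun n => I n z) atTop := by
    intro z
    refine le_trans (le_of_eq ?_) (lintegral_liminf_le fun n => ?_)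
    · refine lintegral_congr_ae ?_
      filter_upwards [hcae 0, hcae h, hcae z, hcae (z + h)] with x a0 a1 a2 a3
      rw [add_zero] at a0
      rw [← add_assoc] at a3
      have t := (((hlim _ a3).sub (hlim _ a2)).sub ((hlim _ a1).sub (hlim _ a0)))
      exact ((ENNReal.continuous_pow 2).tendsto _ |>.comp t.enorm).liminf_eq.symm
    · have := huc n
      exact (Continuous.measurable (by fun_prop)).enorm.pow_const 2
  have h2 : ∀ᵐ z ∂ν, ∫⁻ x, ‖(w (x + z + h) - w (x + z)) - (w (x + h) - w x)‖ₑ ^ 2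
      ≤ liminf (fun n => (Icc (-ε n) (ε n))ᶜ.indicator (I n) z) atTop := by
    have : ∀ᵐ z ∂ν, z ≠ 0 := compl_mem_ae_iff.2 hν.zero
    filter_upwards [this] with z hz
    refine (h1 z).trans (le_of_eq (liminf_congr ?_))
    filter_upwards [hε0.eventually (gt_mem_nhds (abs_pos.2 hz))] with n hn
    rw [indicator_of_mem]
    exact fun hc => (not_le.2 hn) (abs_le.2 hc)
  calc _ ≤ ∫⁻ z, liminf (fun n => (Icc (-ε n) (ε n))ᶜ.indicator (I n) z) atTop ∂ν :=
        lintegral_mono_ae h2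
    _ ≤ liminf (fun n => ∫⁻ z, (Icc (-ε n) (ε n))ᶜ.indicator (I n) z ∂ν) atTop :=
        lintegral_liminf_le fun n => (hIm n).indicator measurableSet_Icc.compl
    _ ≤ liminf (fun _ : ℕ => ENNReal.ofReal (2 * L * γ ^ 2 * h)) atTop := by
        refine liminf_le_liminf (Eventually.of_forall fun n => ?_)
        rw [lintegral_indicator measurableSet_Icc.compl]
        exact (hu n).energy_le hν hg (hε n) hL0 hL hh
    _ = _ := liminf_const _

/-- A nonincreasing function whose increments have small energy with respect to an infinite Lévy
measure has no jumps. -/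
lemma continuous_of_energy_le {ν : Measure ℝ} (hν : IsSymmDiffuseLevy ν) (hν_unbdd : ν univ = ⊤)
    {w : ℝ → ℝ} (hw : Antitone w) {B : ℝ}
    (hE : ∀ h, 0 < h →
      ∫⁻ z, ∫⁻ x, ‖(w (x + z + h) - w (x + z)) - (w (x + h) - w x)‖ₑ ^ 2 ∂volume ∂ν
        ≤ ENNReal.ofReal (B * h)) : Continuous w := by
  rw [continuous_iff_continuousAt]
  intro x₀
  rw [hw.continuousAt_iff_leftLim_eq_rightLim]
  by_contra hne
  set l := Function.leftLim w x₀
  set r := Function.rightLim w x₀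
  have hlr : r < l := lt_of_le_of_ne (hw.rightLim_le_leftLim le_rfl) (Ne.symm hne)
  set J := l - r with hJ
  have hJ0 : 0 < J := sub_pos.2 hlr
  obtain ⟨a, ha, hal⟩ := mem_nhdsLT_iff_exists_Ioo_subset.1
    ((hw.tendsto_leftLim x₀).eventually (gt_mem_nhds (show l < l + J / 2 by linarith)))
  obtain ⟨b, hb, hbr⟩ := mem_nhdsGT_iff_exists_Ioo_subset.1
    ((hw.tendsto_rightLim x₀).eventually (lt_mem_nhds (show r - J / 2 < r by linarith)))
  have hle : ∀ x < x₀, l ≤ w x := fun x hx => hw.leftLim_le hx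
  have hge : ∀ x, x₀ < x → w x ≤ r := fun x hx => hw.le_rightLim hx
  -- With |z| and h below η, the points x + z and x + z + h remain in (a, b) for x in (x₀ - h, x₀).
  set η := min (x₀ - a) (b - x₀) / 2 with hη
  have hη0 : 0 < η := half_pos (lt_min (sub_pos.2 ha) (sub_pos.2 hb))
  have hηa : 2 * η ≤ x₀ - a := by rw [hη]; linarith [min_le_left (x₀ - a) (b - x₀)]
  have hηb : 2 * η ≤ b - x₀ := by rw [hη]; linarith [min_le_right (x₀ - a) (b - x₀)]
  -- For x in (x₀ - h, x₀) the increment at x crosses the jump and is at most -J. The one at x + z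
  -- stays on one side of x₀, as |z| > h, and is at least -J/2. So the energy is at least (J/2)² h
  -- ν(annulus), and h cancels.
  have hann : ∀ h, 0 < h → h < η → ν {z | h < |z| ∧ |z| < η} ≤ ENNReal.ofReal (4 * B / J ^ 2) := by
    intro h hh hhη
    have hAm : MeasurableSet {z : ℝ | h < |z| ∧ |z| < η} :=
      (isOpen_lt continuous_const continuous_abs).measurableSet.inter
        (isOpen_lt continuous_abs continuous_const).measurableSet
    have hpt : ∀ z ∈ {z : ℝ | h < |z| ∧ |z| < η}, ENNReal.ofReal ((J / 2) ^ 2 * h)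
        ≤ ∫⁻ x, ‖(w (x + z + h) - w (x + z)) - (w (x + h) - w x)‖ₑ ^ 2 := by
      intro z hz
      calc ENNReal.ofReal ((J / 2) ^ 2 * h)
          = ∫⁻ _ in Ioo (x₀ - h) x₀, ENNReal.ofReal ((J / 2) ^ 2) := by
            rw [setLIntegral_const, Real.volume_Ioo, ← ENNReal.ofReal_mul (by positivity)]
            congr 2; ring
        _ ≤ ∫⁻ x in Ioo (x₀ - h) x₀,
              ‖(w (x + z + h) - w (x + z)) - (w (x + h) - w x)‖ₑ ^ 2 := by
            refine setLIntegral_mono' measurableSet_Ioo fun x hx => ?_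
            rw [← enorm_pow, Real.enorm_of_nonneg (sq_nonneg _)]
            refine ENNReal.ofReal_le_ofReal ?_
            have h1 : w (x + h) - w x ≤ -J := by
              have := hle x hx.2
              have := hge (x + h) (by linarith [hx.1])
              linarith
            have h2 : -(J / 2) ≤ w (x + z + h) - w (x + z) := by
              rcases lt_abs.1 hz.1 with hz1 | hz1
              · have hz2 := (abs_lt.1 hz.2).2
                have := hge (x + z) (by linarith [hx.1])
                have h3 : r - J / 2 < w (x + z + h) :=
                  hbr ⟨by linarith [hx.1], by linarith [hx.2]⟩
                linarith
              · have hz2 := (abs_lt.1 hz.2).1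
                have := hle (x + z + h) (by linarith [hx.2])
                have h3 : w (x + z) < l + J / 2 :=
                  hal ⟨by linarith [hx.1], by linarith [hx.2]⟩
                linarith
            have h3 : J / 2 ≤ (w (x + z + h) - w (x + z)) - (w (x + h) - w x) := by linarith
            gcongr
        _ ≤ _ := setLIntegral_le_lintegral _ _
    have hmul : ENNReal.ofReal ((J / 2) ^ 2 * h) * ν {z | h < |z| ∧ |z| < η}
        ≤ ENNReal.ofReal (B * h) := by
      rw [← setLIntegral_const]
      exact (setLIntegral_mono' hAm hpt).trans ((setLIntegral_le_lintegral _ _).trans (hE h hh))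
    have hpos : 0 < (J / 2) ^ 2 * h := by positivity
    have : ν {z | h < |z| ∧ |z| < η} ≤ ENNReal.ofReal (B * h) / ENNReal.ofReal ((J / 2) ^ 2 * h) := by
      rw [ENNReal.le_div_iff_mul_le (Or.inl (by simpa using hpos)) (Or.inl ENNReal.ofReal_ne_top),
        mul_comm]
      exact hmul
    refine this.trans (le_of_eq ?_)
    rw [← ENNReal.ofReal_div_of_pos hpos]
    congr 1
    field_simp
    ring
  have hunion : ν {z | 0 < |z| ∧ |z| < η} ≤ ENNReal.ofReal (4 * B / J ^ 2) := by
    have hsub : {z : ℝ | 0 < |z| ∧ |z| < η} ⊆ ⋃ n : ℕ, {z | η / (n + 2) < |z| ∧ |z| < η} := by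
      intro z hz
      obtain ⟨n, hn⟩ := exists_nat_gt (η / |z|)
      refine mem_iUnion.2 ⟨n, ?_, hz.2⟩
      rw [div_lt_iff₀ hz.1] at hn
      rw [div_lt_iff₀ (by positivity)]
      nlinarith [hz.1]
    refine (measure_mono hsub).trans ?_
    have hmono : Monotone fun n : ℕ => {z : ℝ | η / (n + 2) < |z| ∧ |z| < η} := by
      intro n m hnm z hz
      refine ⟨lt_of_le_of_lt ?_ hz.1, hz.2⟩
      have : (n : ℝ) ≤ m := by exact_mod_cast hnm
      gcongr
    rw [hmono.measure_iUnion]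
    refine iSup_le fun n => hann _ (by positivity) ?_
    rw [div_lt_iff₀ (by positivity)]
    nlinarith [(Nat.cast_nonneg n : (0 : ℝ) ≤ n)]
  have hfin := isFiniteMeasure_levyTrunc hν (half_pos hη0)
  have hout : ν (Icc (-(η / 2)) (η / 2))ᶜ < ⊤ := by
    have := hfin.measure_univ_lt_top
    rwa [levyTrunc, Measure.restrict_apply_univ] at this
  have hcover : (univ : Set ℝ) ⊆ ({0} ∪ {z | 0 < |z| ∧ |z| < η}) ∪ (Icc (-(η / 2)) (η / 2))ᶜ := by
    intro z _
    by_cases hz0 : z = 0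
    · exact Or.inl (Or.inl hz0)
    by_cases hz : |z| ≤ η / 2
    · exact Or.inl (Or.inr ⟨abs_pos.2 hz0, by linarith⟩)
    · exact Or.inr fun hc => hz (abs_le.2 hc)
  have : ν univ < ⊤ := by
    refine (measure_mono hcover).trans_lt ((measure_union_le _ _).trans_lt ?_)
    refine ENNReal.add_lt_top.2 ⟨(measure_union_le _ _).trans_lt ?_, hout⟩
    rw [hν.zero, zero_add]
    exact hunion.trans_lt ENNReal.ofReal_lt_top
  exact this.ne hν_unbdd

/-! ### Averaged equation and its limit. -/

lemma IsTruncFront.abs_le {ν : Measure ℝ} {g : ℝ → ℝ} {γ c ε : ℝ} {u : ℝ → ℝ}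
    (hu : IsTruncFront ν g γ c ε u) (x : ℝ) : |u x| ≤ γ :=
  _root_.abs_le.2 ⟨by linarith [hu.nonneg x, hu.le x], hu.le x⟩

/-- The derivative has a sign, so its integral is controlled by the oscillation of `u` alone. This
makes the drift term vanish with c_n without any bound on the derivatives of the fronts. -/
lemma abs_tentAvg_deriv_le {u : ℝ → ℝ} {γ : ℝ} (hanti : Antitone u) (h0 : ∀ x, 0 ≤ u x)
    (hγ : ∀ x, u x ≤ γ) (hu : ContDiff ℝ 1 u) {h : ℝ} (hh : h ≠ 0) (x : ℝ) :
    |tentAvg h (deriv u) x| ≤ 2 * γ / |h| := by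
  have hd : Continuous (deriv u) := hu.continuous_deriv le_rfl
  have hsign : ∀ y, deriv u y ≤ 0 := fun y => hanti.deriv_nonpos
  have hprim : ∀ k : ℝ, k ≠ 0 → |∫ t in (0 : ℝ)..1, deriv u (x + k * t)| ≤ γ / |k| := by
    intro k hk
    have hder : ∀ t ∈ uIcc (0 : ℝ) 1, HasDerivAt (fun t => u (x + k * t) / k)
        (deriv u (x + k * t)) t := by
      intro t _
      have h1 : HasDerivAt (fun t : ℝ => x + k * t) k t := by
        simpa using ((hasDerivAt_id t).const_mul k).const_add x
      have h2 := (((hu.differentiable (by norm_num)) (x + k * t)).hasDerivAt.comp t h1).div_const k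
      exact h2.congr_deriv (by field_simp)
    rw [intervalIntegral.integral_eq_sub_of_hasDerivAt hder
      (Continuous.intervalIntegrable (by fun_prop) _ _), ← sub_div, abs_div]
    gcongr
    rw [abs_le]
    constructor <;> linarith [h0 (x + k * 1), h0 (x + k * 0), hγ (x + k * 1), hγ (x + k * 0)]
  rw [tentAvg, integral_tentMeasure_eq (by fun_prop)]
  have hle : ‖∫ t in (0 : ℝ)..1, (1 - t) * (deriv u (x + h * t) + deriv u (x + h * -t))‖
      ≤ ∫ t in (0 : ℝ)..1, -(deriv u (x + h * t) + deriv u (x + -h * t)) := by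
    refine intervalIntegral.norm_integral_le_of_norm_le zero_le_one ?_
      (Continuous.intervalIntegrable (by fun_prop) _ _)
    refine ae_of_all _ fun t ht => ?_
    have hs : deriv u (x + h * t) + deriv u (x + -h * t) ≤ 0 := add_nonpos (hsign _) (hsign _)
    rw [show x + h * -t = x + -h * t by ring, Real.norm_eq_abs, abs_mul,
      abs_of_nonneg (by linarith [ht.2]), abs_of_nonpos hs]
    exact mul_le_of_le_one_left (by linarith) (by linarith [ht.1])
  rw [← Real.norm_eq_abs]
  refine hle.trans ?_
  rw [intervalIntegral.integral_neg, intervalIntegral.integral_add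
    (Continuous.intervalIntegrable (by fun_prop) _ _)
    (Continuous.intervalIntegrable (by fun_prop) _ _)]
  have h1 := abs_le.1 (hprim h hh)
  have h2 := abs_le.1 (hprim (-h) (neg_ne_zero.2 hh))
  rw [abs_neg] at h2
  rw [show 2 * γ / |h| = γ / |h| + γ / |h| by ring]
  linarith [h1.1, h2.1]

/-- The equation of a front, averaged against the tent kernel. -/
lemma IsTruncFront.averaged_equation {ν : Measure ℝ} (hν : IsSymmDiffuseLevy ν) {g : ℝ → ℝ}
    (hg : Continuous g) {γ c ε : ℝ} (hε : 0 < ε) {u : ℝ → ℝ} (hu : IsTruncFront ν g γ c ε u)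
    {h : ℝ} (hh : h ≠ 0) (x : ℝ) :
    -c * tentAvg h (deriv u) x
      = 2⁻¹ * (∫ z in (Icc (-ε) ε)ᶜ, tentAvg z (secondDiff h u) x / h ^ 2 ∂(sqWeighted ν))
        + tentAvg h (fun y => g (u y)) x := by
  have hfin := isFiniteMeasure_levyTrunc hν hε
  have huc := hu.contDiff.continuous
  have hd : Continuous (deriv u) := hu.contDiff.continuous_deriv (by norm_num)
  have hD := continuous_integral_translate_sub huc hu.abs_le (levyTrunc ν ε)
  rw [← integral_diff_levyTrunc_eq_sqWeighted hν (continuous_tentAvg huc hu.abs_le h).measurable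
    (abs_tentAvg_le hu.abs_le h) (fun z => secondDiff_tentAvg huc z x hh) hε]
  have h1 : -c * tentAvg h (deriv u) x
      = ∫ t, (∫ z, (u (x + h * t + z) - u (x + h * t)) ∂(levyTrunc ν ε))
          + g (u (x + h * t)) ∂tentMeasure := by
    rw [tentAvg, ← integral_const_mul]
    exact integral_congr_ae (ae_of_all _ fun t => hu.equation _)
  have hDt : Integrable (fun t => ∫ z, (u (x + h * t + z) - u (x + h * t)) ∂(levyTrunc ν ε))
      tentMeasure := integrable_tent (hD.comp (by fun_prop : Continuous fun t => x + h * t))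
  rw [h1, integral_add hDt (integrable_tent (by fun_prop))]
  change _ = _ + ∫ t, g (u (x + h * t)) ∂tentMeasure
  congr 1
  rw [integral_integral_swap]
  · refine integral_congr_ae (ae_of_all _ fun z => ?_)
    simp only [tentAvg]
    rw [← integral_sub (integrable_tent (by fun_prop)) (integrable_tent (by fun_prop))]
    congr 1; ext t
    rw [show x + h * t + z = x + z + h * t by ring]
  · refine Integrable.of_bound (C := γ + γ) (Continuous.aestronglyMeasurable ?_)
      (ae_of_all _ fun p => (abs_sub _ _).trans (add_le_add (hu.abs_le _) (hu.abs_le _)))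
    simp only [Function.uncurry_def]
    fun_prop

/-- Passing to the limit in the averaged equation. -/
lemma averaged_equation_of_tendsto {ν : Measure ℝ} {r₀ : ℝ} (hν : IsSymmDiffuseLevy ν)
    (hsupp : ν.support ⊆ Ioo (-r₀) r₀) {g : ℝ → ℝ}
    (hg : Continuous g) {γ : ℝ} {c ε : ℕ → ℝ} (hε : ∀ n, 0 < ε n)
    (hε0 : Tendsto ε atTop (𝓝 0)) (hc0 : Tendsto c atTop (𝓝 0)) {u : ℕ → ℝ → ℝ}
    (hu : ∀ n, IsTruncFront ν g γ (c n) (ε n) (u n)) {w : ℝ → ℝ}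
    (hlim : ∀ x, Tendsto (fun n => u n x) atTop (𝓝 (w x))) {h : ℝ} (hh : h ≠ 0) (x : ℝ) :
    ∫ z, tentAvg z (secondDiff h w) x ∂(sqWeighted ν)
      = -2 * h ^ 2 * tentAvg h (fun y => g (w y)) x := by
  have hfin : IsFiniteMeasure (sqWeighted ν) := isFiniteMeasure_sqWeighted hν hsupp
  have huc : ∀ n, Continuous (u n) := fun n => (hu n).contDiff.continuous
  obtain ⟨Cg, hCg⟩ := isCompact_Icc (a := 0) (b := γ) |>.exists_bound_of_continuousOn hg.continuousOn
  have hleft : Tendsto (fun n => -c n * tentAvg h (deriv (u n)) x) atTop (𝓝 0) := by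
    have hb : Tendsto (fun n => |c n| * (2 * γ / |h|)) atTop (𝓝 0) := by
      simpa using hc0.abs.mul_const (2 * γ / |h|)
    refine squeeze_zero_norm (fun n => ?_) hb
    rw [Real.norm_eq_abs, abs_mul, abs_neg]
    gcongr
    exact abs_tentAvg_deriv_le (hu n).antitone (hu n).nonneg (hu n).le
      ((hu n).contDiff.of_le (by norm_num)) hh x
  have hg_lim : Tendsto (fun n => tentAvg h (fun y => g (u n y)) x) atTop
      (𝓝 (tentAvg h (fun y => g (w y)) x)) :=
    tendsto_tentAvg (fun n => hg.comp (huc n)) (C := Cg)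
      (fun n x => hCg _ ⟨(hu n).nonneg x, (hu n).le x⟩)
      (fun x => (hg.tendsto _).comp (hlim x)) h x
  have hπ_lim : Tendsto (fun n => ∫ z in (Icc (-ε n) (ε n))ᶜ,
      tentAvg z (secondDiff h (u n)) x / h ^ 2 ∂(sqWeighted ν)) atTop
      (𝓝 (∫ z, tentAvg z (secondDiff h w) x / h ^ 2 ∂(sqWeighted ν))) := by
    simp_rw [← integral_indicator measurableSet_Icc.compl]
    -- For fixed h the integrand is bounded uniformly in n, and z² dν is finite, so a constant
    -- dominates.
    have hbd : ∀ n z, ‖tentAvg z (secondDiff h (u n)) x / h ^ 2‖ ≤ 4 * γ / h ^ 2 := by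
      intro n z
      rw [Real.norm_eq_abs, abs_div, abs_of_nonneg (sq_nonneg h)]
      gcongr
      exact abs_tentAvg_le (abs_secondDiff_le (hu n).abs_le h) z x
    refine tendsto_integral_of_dominated_convergence (fun _ => 4 * γ / h ^ 2) (fun n => ?_)
      (integrable_const _) (fun n => ?_) ?_
    · exact ((continuous_tentAvg_left (continuous_secondDiff (huc n) h)
        (abs_secondDiff_le (hu n).abs_le h) x).div_const _).aestronglyMeasurable.indicator
        measurableSet_Icc.compl
    · exact ae_of_all _ fun z => (norm_indicator_le_norm_self _ _).trans (hbd n z)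
    · have : ∀ᵐ z ∂(sqWeighted ν), z ≠ 0 :=
        (sqWeighted_absolutelyContinuous ν).ae_le (compl_mem_ae_iff.2 hν.zero)
      filter_upwards [this] with z hz
      have ht : Tendsto (fun n => tentAvg z (secondDiff h (u n)) x / h ^ 2) atTop
          (𝓝 (tentAvg z (secondDiff h w) x / h ^ 2)) :=
        (tendsto_tentAvg (fun n => continuous_secondDiff (huc n) h)
          (fun n => abs_secondDiff_le (hu n).abs_le h)
          (fun y => ((hlim _).add (hlim _)).sub ((hlim _).const_mul 2)) z x).div_const _
      refine ht.congr' ?_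
      filter_upwards [hε0.eventually (gt_mem_nhds (abs_pos.2 hz))] with n hn
      rw [indicator_of_mem]
      exact fun hc => (not_le.2 hn) (_root_.abs_le.2 hc)
  have heq := tendsto_nhds_unique (hleft.congr fun n =>
    (hu n).averaged_equation hν hg (hε n) hh x) ((hπ_lim.const_mul 2⁻¹).add hg_lim)
  rw [integral_div] at heq
  field_simp at heq
  linarith

/-! ### Decay of large-scale averages and limits at infinity. -/

/-- The left side of the averaged equation is bounded independently of the scale, while the right
side carries R². -/
lemma abs_tentAvg_le_of_averaged {π : Measure ℝ} [IsFiniteMeasure π] {w F : ℝ → ℝ} {C : ℝ}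
    (hC : ∀ x, |w x| ≤ C)
    (heq : ∀ h, h ≠ 0 → ∀ x, ∫ z, tentAvg z (secondDiff h w) x ∂π = -2 * h ^ 2 * tentAvg h F x)
    {R : ℝ} (hR : 0 < R) (x : ℝ) : |tentAvg R F x| ≤ 2 * C * π.real univ / R ^ 2 := by
  have h1 := heq R hR.ne' x
  have h2 := norm_integral_le_of_norm_le_const (μ := π)
    (f := fun z => tentAvg z (secondDiff R w) x) (C := 4 * C)
    (ae_of_all _ fun z => abs_tentAvg_le (abs_secondDiff_le hC R) z x)
  rw [h1, Real.norm_eq_abs, abs_mul, abs_mul, abs_of_nonneg (sq_nonneg R)] at h2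
  rw [le_div_iff₀ (by positivity)]
  norm_num at h2
  linarith

/-- The nonlinearity vanishes at the limits of a solution of the averaged equation. -/
lemma eq_zero_of_tentAvg_bound {F : ℝ → ℝ} (hF : Continuous F) {C D : ℝ} (hC : ∀ x, |F x| ≤ C)
    (hD : ∀ R, 0 < R → ∀ x, |tentAvg R F x| ≤ D / R ^ 2) {l : Filter ℝ} [l.NeBot]
    [l.IsCountablyGenerated] (hl : ∀ a : ℝ, Tendsto (fun x => x + a) l l) {s : ℝ}
    (hs : Tendsto F l (𝓝 s)) : s = 0 := by
  have h1 : ∀ R, 0 < R → |s| ≤ D / R ^ 2 := by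
    intro R hR
    have ht : Tendsto (fun x => tentAvg R F x) l (𝓝 (∫ _, s ∂tentMeasure)) := by
      refine tendsto_integral_filter_of_dominated_convergence (fun _ => C) ?_ ?_
        (integrable_const C) ?_
      · exact Eventually.of_forall fun x => Continuous.aestronglyMeasurable (by fun_prop)
      · exact Eventually.of_forall fun x => ae_of_all _ fun t => hC _
      · exact ae_of_all _ fun t => hs.comp (hl _)
    rw [integral_const, probReal_univ, one_smul] at ht
    exact le_of_tendsto ht.abs (Eventually.of_forall fun x => hD R hR x)
  have h2 : Tendsto (fun R : ℝ => D / R ^ 2) atTop (𝓝 0) :=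
    (tendsto_pow_atTop two_ne_zero).const_div_atTop D
  have h3 : |s| ≤ 0 := ge_of_tendsto h2 ((eventually_gt_atTop 0).mono h1)
  exact abs_eq_zero.1 (le_antisymm h3 (abs_nonneg s))

lemma half_le_tentMeasure_Icc {s : ℝ} (hs : s ≤ 1 / 2) :
    s / 2 ≤ tentMeasure.real (Icc 0 s) := by
  have h : ENNReal.ofReal (s / 2) ≤ tentMeasure (Icc 0 s) := by
    rw [tentMeasure, withDensity_apply _ measurableSet_Icc]
    calc ENNReal.ofReal (s / 2) = ∫⁻ _ in Icc 0 s, ENNReal.ofReal (1 / 2) := by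
          rw [setLIntegral_const, Real.volume_Icc, ← ENNReal.ofReal_mul (by norm_num)]
          congr 1; ring
      _ ≤ _ := by
          refine setLIntegral_mono' measurableSet_Icc fun t ht => ENNReal.ofReal_le_ofReal ?_
          rw [abs_of_nonneg ht.1]
          linarith [ht.2]
  exact (ENNReal.ofReal_le_iff_le_toReal (measure_ne_top _ _)).1 h

/-- A function of constant sign whose tent averages decay quadratically in the scale vanishes. -/
lemma not_neg_of_tentAvg_bound {F : ℝ → ℝ} (hF : Continuous F) {D : ℝ}
    (hD : ∀ R, 0 < R → ∀ x, |tentAvg R F x| ≤ D / R ^ 2) (hneg : ∀ x, F x ≤ 0) : ¬ F 0 < 0 := by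
  intro h0
  obtain ⟨d, hd0, hd⟩ : ∃ d > 0, ∀ x ∈ Icc 0 d, F x ≤ F 0 / 2 := by
    have := hF.tendsto 0 |>.eventually (gt_mem_nhds (show F 0 < F 0 / 2 by linarith))
    obtain ⟨d, hd0, hd⟩ := Metric.eventually_nhds_iff.1 this
    refine ⟨d / 2, by positivity, fun x hx => (hd ?_).le⟩
    rw [Real.dist_eq, sub_zero, abs_of_nonneg hx.1]
    linarith [hx.2]
  -- At scale R the interval [0, d] keeps tent mass at least d/(2R), so the average is at least of
  -- order 1/R in size, against the assumed 1/R².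
  have key : ∀ R, 2 * d ≤ R → -F 0 / 2 * (d / R / 2) ≤ D / R ^ 2 := by
    intro R hR
    have hR0 : 0 < R := by linarith
    have h1 : tentAvg R F 0 ≤ ∫ t, (Icc 0 (d / R)).indicator (fun _ => F 0 / 2) t ∂tentMeasure := by
      refine integral_mono (integrable_tent (by fun_prop))
        ((integrable_const _).indicator measurableSet_Icc) fun t => ?_
      by_cases ht : t ∈ Icc 0 (d / R)
      · rw [indicator_of_mem ht, zero_add]
        refine hd _ ⟨mul_nonneg hR0.le ht.1, ?_⟩
        have := (le_div_iff₀ hR0).1 ht.2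
        linarith
      · rw [indicator_of_notMem ht]; exact hneg _
    rw [integral_indicator measurableSet_Icc, setIntegral_const, smul_eq_mul] at h1
    have h2 := half_le_tentMeasure_Icc (s := d / R) (by
      rw [div_le_iff₀ hR0]; linarith)
    have h3 := (abs_le.1 (hD R hR0 0)).1
    nlinarith
  have hlim : Tendsto (fun R : ℝ => D / R) atTop (𝓝 0) := tendsto_const_nhds.div_atTop tendsto_id
  have hle : -F 0 / 2 * (d / 2) ≤ 0 := by
    refine ge_of_tendsto hlim ?_
    filter_upwards [eventually_ge_atTop (2 * d)] with R hR
    have hR0 : 0 < R := by linarith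
    have := key R hR
    rw [le_div_iff₀ (by positivity)] at this ⊢
    calc -F 0 / 2 * (d / 2) * R = -F 0 / 2 * (d / R / 2) * R ^ 2 := by field_simp
      _ ≤ D := this
  nlinarith

/-! ### Positivity of the limit. -/

/-- A nonnegative nonincreasing stationary solution does not touch zero. -/
lemma pos_of_hasNonlocalOp {ν : Measure ℝ} (hν : IsSymmDiffuseLevy ν) (hν_ne : ν univ ≠ 0)
    {w : ℝ → ℝ} (hw : Continuous w) (hanti : Antitone w) (h0 : ∀ x, 0 ≤ w x) {y : ℝ} (hy : 0 < w y)
    {g : ℝ → ℝ} (hg0 : g 0 = 0) (hD : ∀ᵐ x, HasNonlocalOp ν w x (-g (w x))) (x : ℝ) : 0 < w x := by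
  by_contra hx
  have hwx : w x = 0 := le_antisymm (not_lt.1 hx) (h0 x)
  set S := {x | w x = 0}
  have hSne : S.Nonempty := ⟨x, hwx⟩
  have hSb : BddBelow S := ⟨y, fun a ha => by
    by_contra hc
    have := hanti (not_le.1 hc).le
    rw [show w a = 0 from ha] at this
    linarith⟩
  have hSc : IsClosed S := isClosed_eq hw continuous_const
  set x₀ := sInf S
  have hx₀ : w x₀ = 0 := hSc.csInf_mem hSne hSb
  have hleft : ∀ a < x₀, 0 < w a := fun a ha =>
    lt_of_le_of_ne (h0 a) fun hc => (notMem_of_lt_csInf ha hSb) hc.symm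
  have hright : ∀ a, x₀ ≤ a → w a = 0 := fun a ha =>
    le_antisymm ((hanti ha).trans hx₀.le) (h0 a)
  -- Take a point `a` just to the right of the first zero where the equation holds. There the
  -- integrals of w(a + z) over |z| > δ increase to 0 as δ decreases, so they all vanish. Since w(a
  -- + z) > 0 for z < -η, ν has no mass there; symmetry then makes ν zero.
  have hnull : ∀ η : ℝ, 0 < η → ν (Iio (-η)) = 0 := by
    intro η hη
    obtain ⟨a, ⟨ha1, ha2⟩, haD⟩ : ∃ a ∈ Ioo x₀ (x₀ + η), HasNonlocalOp ν w a (-g (w a)) := by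
      by_contra hc
      push Not at hc
      have : volume (Ioo x₀ (x₀ + η)) = 0 := measure_mono_null hc hD
      rw [Real.volume_Ioo] at this
      simp at this
      linarith
    have hwa : w a = 0 := hright a ha1.le
    obtain ⟨hint, hlim⟩ := haD
    simp only [hwa, hg0, sub_zero, neg_zero] at hint hlim
    have hIle : ∫ z, w (a + z) ∂(levyTrunc ν η) ≤ 0 := by
      refine ge_of_tendsto hlim ?_
      filter_upwards [Ioc_mem_nhdsGT hη] with δ hδ
      refine integral_mono_measure (Measure.restrict_mono_set _ ?_)
        (ae_of_all _ fun z => h0 _) (hint δ hδ.1)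
      exact compl_subset_compl.2 (Icc_subset_Icc (neg_le_neg hδ.2) hδ.2)
    have hI0 : ∫ z, w (a + z) ∂(levyTrunc ν η) = 0 :=
      le_antisymm hIle (integral_nonneg fun z => h0 _)
    rw [integral_eq_zero_iff_of_nonneg (fun z => h0 _) (hint η hη)] at hI0
    have hz : ∀ᵐ z ∂(levyTrunc ν η), ¬ z < -η := by
      filter_upwards [hI0] with z hz hlt
      exact (hleft (a + z) (by linarith)).ne' hz
    rw [levyTrunc, ae_restrict_iff' measurableSet_Icc.compl] at hz
    refine measure_mono_null (fun z hz => ?_) hz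
    simp only [mem_compl_iff, mem_ofPred_eq, mem_Icc, not_and, not_le, mem_Iio] at hz ⊢
    push Not
    exact ⟨fun h => by linarith, hz⟩
  have hneg : ν (Iio 0) = 0 := by
    have hsub : Iio (0 : ℝ) ⊆ ⋃ n : ℕ, Iio (-(1 / ((n : ℝ) + 1))) := by
      intro z hz
      obtain ⟨n, hn⟩ := exists_nat_one_div_lt (neg_pos.2 (show z < 0 from hz))
      exact mem_iUnion.2 ⟨n, by simp only [mem_Iio]; linarith⟩
    exact measure_mono_null hsub (measure_iUnion_null fun n => hnull _ (by positivity))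
  have hpos : ν (Ioi 0) = 0 := by
    rw [← hν.symm, Measure.map_apply (by fun_prop) measurableSet_Ioi]
    convert hneg using 2
    ext z; simp
  apply hν_ne
  have : (univ : Set ℝ) = Iio 0 ∪ {0} ∪ Ioi 0 := by
    ext z
    rcases lt_trichotomy z 0 with h | h | h <;> simp [h]
  rw [this]
  exact measure_union_null (measure_union_null hneg hν.zero) hpos

/-! ### Assembly. -/

lemma exists_lipschitz_bound {g : ℝ → ℝ} (hg : ContDiff ℝ 1 g) (γ : ℝ) :
    ∃ L, 0 ≤ L ∧ ∀ s ∈ Icc 0 γ, ∀ t ∈ Icc 0 γ, |g s - g t| ≤ L * |s - t| := by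
  obtain ⟨L, hL⟩ := isCompact_Icc (a := 0) (b := γ) |>.exists_bound_of_continuousOn
    (hg.continuous_deriv le_rfl).continuousOn
  refine ⟨max L 0, le_max_right _ _, fun s hs t ht => ?_⟩
  exact (convex_Icc 0 γ).norm_image_sub_le_of_norm_deriv_le
    (fun x _ => (hg.differentiable (by norm_num)) x)
    (fun x hx => (hL x hx).trans (le_max_left _ _)) ht hs

theorem lemma3p1 (g : ℝ → ℝ) (θ γ : ℝ) (hg : IsBistable g θ γ)
    (ν : Measure ℝ) (hν : IsSymmDiffuseLevy ν) (hν_unbdd : ν univ = ⊤)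
    (r₀ : ℝ) (hr₀ : 0 < r₀) (hν_supp : ν.support ⊆ Ioo (-r₀) r₀)
    (ε : ℕ → ℝ) (hε_pos : ∀ n, 0 < ε n) (hε : Tendsto ε atTop (𝓝 0))
    (c : ℕ → ℝ) (hc_pos : ∀ n, 0 < c n) (hc : Tendsto c atTop (𝓝 0))
    (m : ℕ → ℝ → ℝ) (hm_smooth : ∀ n, ContDiff ℝ 2 (m n))
    (hm : ∀ n, IsFront (levyTrunc ν (ε n)) g γ (c n) (m n)) :
    ∃ w : ℝ → ℝ, Continuous w ∧ (∀ x, 0 < w x) ∧ Antitone w ∧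
      (∀ᵐ x : ℝ, ∃ L : ℝ, HasNonlocalOp ν w x L ∧ L + g (w x) = 0) ∧
      Tendsto w atBot (𝓝 γ) ∧ Tendsto w atTop (𝓝 0) := by
  have hgc : Continuous g := hg.contDiff.continuous
  have hθ := hg.theta_pos
  have hθγ := hg.theta_lt
  have hfin : IsFiniteMeasure (sqWeighted ν) := isFiniteMeasure_sqWeighted hν hν_supp
  -- The level θ/2 lies strictly between the zeros 0 and θ: it forces the limit 0 at +∞ and makes
  -- g(w(0)) negative.
  choose u hu hu0 using fun n => (hm n).exists_isTruncFront hν hgc (hε_pos n) (hm_smooth n)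
    (s := θ / 2) ⟨by linarith, by linarith⟩
  obtain ⟨φ, w, hφ, hanti, hw0, hwγ, hlim⟩ := exists_subseq_tendsto_of_antitone
    (fun n => (hu n).antitone) (fun n => (hu n).nonneg) (fun n => (hu n).le)
  have hεφ := hε.comp hφ.tendsto_atTop
  have hcφ := hc.comp hφ.tendsto_atTop
  obtain ⟨L, hL0, hL⟩ := exists_lipschitz_bound hg.contDiff γ
  have hwc : Continuous w := continuous_of_energy_le hν hν_unbdd hanti fun h hh =>
    energy_le_of_tendsto hν hgc (fun n => hε_pos (φ n)) hεφ (fun n => hu (φ n)) hL0 hL hanti hlim hh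
  have hlim' : ∀ x, Tendsto (fun n => u (φ n) x) atTop (𝓝 (w x)) := fun x =>
    hlim x hwc.continuousAt
  have hwzero : w 0 = θ / 2 := tendsto_nhds_unique (hlim' 0) (by simp [hu0])
  have hwb : ∀ x, |w x| ≤ γ := fun x => abs_le.2 ⟨by linarith [hw0 x, hwγ x], hwγ x⟩
  have heq : ∀ h, h ≠ 0 → ∀ x, ∫ z, tentAvg z (secondDiff h w) x ∂(sqWeighted ν)
      = -2 * h ^ 2 * tentAvg h (fun y => g (w y)) x := fun h hh x =>
    averaged_equation_of_tendsto hν hν_supp hgc (fun n => hε_pos (φ n)) hεφ hcφ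
      (fun n => hu (φ n)) hlim' hh x
  have hFc : Continuous fun y => g (w y) := hgc.comp hwc
  obtain ⟨Cg, hCg⟩ := isCompact_Icc (a := 0) (b := γ) |>.exists_bound_of_continuousOn
    hgc.continuousOn
  have hFb : ∀ x, |g (w x)| ≤ Cg := fun x => hCg _ ⟨hw0 x, hwγ x⟩
  -- the equation
  have hγ0 : 0 ≤ γ := by linarith
  -- The maximum with 1 lets one constant serve both `w` and g ∘ w.
  set K := max L 1 ^ 2 * γ ^ 2
  have hFK : HasHalfModulus K (fun y => g (w y)) :=
    hasHalfModulus_of_abs_sub_le hanti hw0 hwγ fun x y =>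
      (hL _ ⟨hw0 x, hwγ x⟩ _ ⟨hw0 y, hwγ y⟩).trans (by gcongr; exact le_max_left _ _)
  have hwK : HasHalfModulus K w :=
    hasHalfModulus_of_abs_sub_le hanti hw0 hwγ fun x y =>
      le_mul_of_one_le_left (abs_nonneg _) (le_max_right _ _)
  have hop := ae_hasNonlocalOp hν hr₀ hν_supp hwc hwb (by positivity) hwK hFc hFb hFK heq
  have hpos := pos_of_hasNonlocalOp hν (by simp [hν_unbdd]) hwc hanti hw0
    (y := 0) (by rw [hwzero]; linarith) hg.zero hop
  -- the limits at infinity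
  have hdecay : ∀ R, 0 < R → ∀ x, |tentAvg R (fun y => g (w y)) x|
      ≤ 2 * γ * (sqWeighted ν).real univ / R ^ 2 := fun R hR x =>
    abs_tentAvg_le_of_averaged hwb heq hR x
  have htop := tendsto_atTop_ciInf hanti ⟨0, by rintro _ ⟨x, rfl⟩; exact hw0 x⟩
  have hbot := tendsto_atBot_ciSup hanti ⟨γ, by rintro _ ⟨x, rfl⟩; exact hwγ x⟩
  set s := ⨅ x, w x
  set t := ⨆ x, w x
  have hgs : g s = 0 := eq_zero_of_tentAvg_bound hFc hFb hdecay
    (fun a => tendsto_atTop_add_const_right _ a tendsto_id) ((hgc.tendsto s).comp htop)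
  have hgt : g t = 0 := eq_zero_of_tentAvg_bound hFc hFb hdecay
    (fun a => tendsto_atBot_add_const_right _ a tendsto_id) ((hgc.tendsto t).comp hbot)
  have hs0 : 0 ≤ s := ge_of_tendsto' htop hw0
  have hsθ : s ≤ θ / 2 := hwzero ▸ hanti.le_of_tendsto htop 0
  have htθ : θ / 2 ≤ t := hwzero ▸ hanti.ge_of_tendsto hbot 0
  have htγ : t ≤ γ := le_of_tendsto' hbot hwγ
  have hs : s = 0 := by
    by_contra hne
    exact (hg.neg s ⟨lt_of_le_of_ne hs0 (Ne.symm hne), by linarith⟩).ne hgs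
  have ht : t = γ := by
    by_contra hne
    have htγ' : t < γ := lt_of_le_of_ne htγ hne
    rcases lt_trichotomy t θ with h | h | h
    · exact (hg.neg t ⟨by linarith, h⟩).ne hgt
    -- If the limit at -∞ were θ, then 0 < w ≤ θ and g ∘ w would be nonpositive everywhere and
    -- negative at 0.
    · refine not_neg_of_tentAvg_bound hFc hdecay (fun x => ?_) ?_
      · have hx : w x ≤ θ := h ▸ hanti.ge_of_tendsto hbot x
        rcases hx.lt_or_eq with hx | hx
        · exact (hg.neg _ ⟨hpos x, hx⟩).le
        · rw [hx, hg.theta_zero]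
      · simp only [hwzero]
        exact hg.neg _ ⟨by linarith, by linarith⟩
    · exact (hg.pos t ⟨h, htγ'⟩).ne' hgt
  exact ⟨w, hwc, hpos, hanti, hop.mono fun x hx => ⟨_, hx, by ring⟩, ht ▸ hbot, hs ▸ htop⟩
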